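/- **Theorem (Chern–Connes pairing table).** Let $\theta\in\mathbb R$, $\lambda=e^{2\pi i\theta}$, and let $\sqrt\lambda$ be a square root of $\lambda$. Let $\mathcal A_\theta^{alg}$ be the algebra of finite sums $\sum a_{n,m}U_1^nU_2^m$ with $U_1,U_2$ invertible and $U_2U_1=\lambda U_1U_2$, let $\sigma$ be its automorphism $U_j\mapsto U_j^{-1}$, and let $\mathcal A_\theta^{alg}\rtimes\mathbb Z_2=\{a+bt\}$, where $t^2=1$ and $tat=\sigma(a)$. Consider the five idempotents $$1,\qquad p=\tfrac12(1+t),\qquad q_1=\tfrac12(1-U_1t),\qquad q_2=\tfrac12(1-U_2t),\qquad r=\tfrac12(1-\sqrt\lambda\,U_1U_2t)$$ and the following cyclic cocycles on $\mathcal A_\theta^{alg}\rtimes\mathbb Z_2$: * the trace $\tau(a+bt)=a_{0,0}$; * for $i,j\in\{0,1\}$, the trace $\mathcal D_{i,j}(a+bt)=\mathcal D_{i,j}(b)$, where on the right $\mathcal D_{i,j}$ is the functional on $\mathcal A_\theta^{alg}$ with $\mathcal D_{i,j}(xy)=\mathcal D_{i,j}(y\,\sigma(x))$ for all $x,y$,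 supported on the monomials $U_1^nU_2^m$ with $n\equiv i$, $m\equiv j \pmod 2$ and normalized by $\mathcal D_{i,j}(U_1^iU_2^j)=1$; explicitly $\mathcal D_{i,j}(U_1^nU_2^m)=\lambda^{-(nm-ij)/2}$ on these monomials; * Connes' cyclic 2-cocycle $\varphi$, the extension of $\varphi(a_0,a_1,a_2)=\frac1{2\pi i}\tau\big(a_0(\delta_1(a_1)\delta_2(a_2)-\delta_2(a_1)\delta_1(a_2))\big)$ on $\mathcal A_\theta^{alg}$, where $\delta_j$ is the derivation with $\delta_j(U_k)=2\pi i\,\delta_{jk}U_k$, by $\varphi(a_0t^{g_0},a_1t^{g_1},a_2t^{g_2})=\varphi(a_0,\sigma^{g_0}(a_1),\sigma^{g_0+g_1}(a_2))$ if $g_0+g_1+g_2$ is even and $0$ otherwise. Let $S$ be Connes' periodicity operator, so that $(Sf)(x_0,x_1,x_2)=f(x_0x_1x_2)$ for a trace $f$, and let $HC^{even}=\varinjlim_S HC^{2n}$. Let $\langle\cdot,\cdot\rangle: K_0\times HC^{even}\to\mathbb C$ be the Chern–Connes pairing, $\langle[e],[\psi]\rangle=\frac1{n!}(\psi\#\mathrm{Tr})(e,\dots,e)$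 for an idempotent matrix $e$ and a cyclic $2n$-cocycle $\psi$. Then the pairings of these idempotents with the classes of $S\tau$, $S\mathcal D_{i,j}$ and $\varphi$ in $HC^{even}(\mathcal A_\theta^{alg}\rtimes\mathbb Z_2)$ are $$\begin{array}{c||c|c|c|c|c|c} & S\tau & S\mathcal D_{0,0} & S\mathcal D_{1,0} & S\mathcal D_{0,1} & S\mathcal D_{1,1} & \varphi\\ \hline\hline 1 & 1 & 0 & 0 & 0 & 0 & 0\\ \hline p & \tfrac12 & \tfrac12 & 0 & 0 & 0 & 0\\ \hline q_1 & \tfrac12 & 0 & -\tfrac12 & 0 & 0 & 0\\ \hline q_2 & \tfrac12 & 0 & 0 & -\tfrac12 & 0 & 0\\ \hline r & \tfrac12 & 0 & 0 & 0 & -\tfrac{\sqrt\lambda}2 & 0 \end{array}$$ Moreover, the classes $[1],[p],[q_1],[q_2],[r]$ are linearly independent (over $\mathbb Z$) in $K_0(\mathcal A_\theta^{alg}\rtimes\mathbb Z_2)$. -/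

import Mathlib

namespace ChernConnes

noncomputable section

/-! ## Cyclic cohomology of a unital complex algebra -/

section Cyclic

variable {B : Type*} [Ring B] [Algebra ℂ B]

/-- Hochschild `n`-cochains: `(n+1)`-linear functionals on `B`. -/
abbrev Cochain (B : Type*) [Ring B] [Algebra ℂ B] (n : ℕ) : Type _ :=
  MultilinearMap ℂ (fun _ : Fin (n + 1) => B) ℂ

/-- The face maps: `(a₀, …, aₙ₊₁) ↦ (a₀, …, aᵢ aᵢ₊₁, …, aₙ₊₁)` for `i ≤ n`, and
`(a₀, …, aₙ₊₁) ↦ (aₙ₊₁ a₀, a₁, …, aₙ)` for `i = n + 1`. -/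
def face {n : ℕ} (i : Fin (n + 2)) (a : Fin (n + 2) → B) : Fin (n + 1) → B := fun k =>
  if i = Fin.last (n + 1) ∧ k = 0 then a (Fin.last (n + 1)) * a 0
  else i.contractNth (· * ·) a k

theorem face_update {n : ℕ} (i : Fin (n + 2)) (a : Fin (n + 2) → B) (j : Fin (n + 2)) :
    ∃ (k : Fin (n + 1)) (L : B →ₗ[ℂ] B), ∀ x,
      face i (Function.update a j x) = Function.update (face i a) k (L x) := by
  by_cases hi : i = Fin.last (n + 1)
  · subst hi
    induction j using Fin.lastCases with
    | last =>
      refine ⟨0, LinearMap.mulRight ℂ (a 0), fun x => ?_⟩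
      funext k
      by_cases hk : k = 0
      · subst hk
        simp [face, Function.update, Fin.ext_iff]
      · have : (k : ℕ) < n + 1 := k.2
        have h2 : k.castSucc ≠ Fin.last (n + 1) := (Fin.castSucc_lt_last k).ne
        simp [face, hk, Fin.contractNth, this, h2]
    | cast j =>
      by_cases hj : j = 0
      · subst hj
        refine ⟨0, LinearMap.mulLeft ℂ (a (Fin.last _)), fun x => ?_⟩
        funext k
        by_cases hk : k = 0
        · subst hk
          simp [face, Function.update, Fin.ext_iff]
        · simp [face, hk, Fin.contractNth, Function.update_of_ne]
      · refine ⟨j, LinearMap.id, fun x => ?_⟩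
        funext k
        by_cases hk : k = 0
        · subst hk
          have h1 : (0 : Fin (n + 1)) ≠ j := fun h => hj h.symm
          have h2 : (0 : Fin (n + 2)) ≠ j.castSucc := by
            simpa [Fin.ext_iff] using fun h : (0 : ℕ) = j => hj (Fin.ext h.symm)
          have h3 : Fin.last (n + 1) ≠ j.castSucc := (Fin.castSucc_lt_last j).ne'
          simp [face, h1, h2, h3]
        · by_cases hkj : k = j
          · subst hkj
            have : (k : ℕ) < n + 1 := k.2
            simp [face, hk, Fin.contractNth, this]
          · have : (k : ℕ) < n + 1 := k.2
            simp [face, hk, hkj, Fin.contractNth, this]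
  · have hi' : (i : ℕ) < n + 1 := by
      have := i.2
      have : (i : ℕ) ≠ n + 1 := fun h => hi (Fin.ext h)
      omega
    rcases lt_trichotomy (j : ℕ) i with hj | hj | hj
    · refine ⟨⟨j, by omega⟩, LinearMap.id, fun x => ?_⟩
      funext k
      simp only [face, hi, false_and, if_false, Fin.contractNth, Function.update_apply, Fin.ext_iff, LinearMap.id_apply,
        Fin.val_castSucc, Fin.val_succ]
      grind
    · refine ⟨⟨j, by omega⟩, LinearMap.mulRight ℂ (a ⟨j + 1, by omega⟩), fun x => ?_⟩
      funext k
      simp only [face, hi, false_and, if_false, Fin.contractNth, Function.update_apply, Fin.ext_iff,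
        Fin.val_castSucc, Fin.val_succ]
      rcases lt_trichotomy (k : ℕ) i with hk | hk | hk
      · grind
      · have : k.succ = ⟨j + 1, by omega⟩ := Fin.ext (by simp; omega)
        simp [hk, hj, this]
      · grind
    · refine ⟨⟨j - 1, by omega⟩, if (j : ℕ) = i + 1 then LinearMap.mulLeft ℂ (a i)
        else LinearMap.id, fun x => ?_⟩
      funext k
      simp only [face, hi, false_and, if_false, Fin.contractNth, Function.update_apply, Fin.ext_iff,
        Fin.val_castSucc, Fin.val_succ]
      rcases lt_trichotomy (k : ℕ) i with hk | hk | hk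
      · grind
      · have : k.castSucc = i := Fin.ext (by simpa using hk)
        by_cases hj' : (j : ℕ) = i + 1
        · simp [hk, hj', this]
        · grind
      · have hj' : (k : ℕ) = j - 1 → (j : ℕ) ≠ i + 1 := by omega
        split_ifs <;> first | rfl | omega

/-- The cochain `φ ∘ dᵢ` for the `i`-th face map `dᵢ`. -/
def coface {n : ℕ} (i : Fin (n + 2)) (φ : Cochain B n) : Cochain B (n + 1) :=
  MultilinearMap.mk' (fun a => φ (face i a))
    (fun a j x y => by
      obtain ⟨k, L, h⟩ := face_update i a j
      simp [h])
    (fun a j c x => by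
      obtain ⟨k, L, h⟩ := face_update i a j
      simp [h])

@[simp] theorem coface_apply {n : ℕ} (i : Fin (n + 2)) (φ : Cochain B n) (a : Fin (n + 2) → B) :
    coface i φ a = φ (face i a) := rfl

/-- The Hochschild coboundary
`(bφ)(a₀, …, aₙ₊₁) = ∑_{i ≤ n} (-1)ⁱ φ(a₀, …, aᵢ aᵢ₊₁, …, aₙ₊₁) + (-1)ⁿ⁺¹ φ(aₙ₊₁ a₀, a₁, …, aₙ)`. -/
def hochschildB {n : ℕ} (φ : Cochain B n) : Cochain B (n + 1) :=
  ∑ i : Fin (n + 2), (-1 : ℂ) ^ (i : ℕ) • coface i φ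

/-- Cyclic cochains: `φ(aₙ, a₀, …, aₙ₋₁) = (-1)ⁿ φ(a₀, …, aₙ)`.
(Indices live in `Fin (n + 1)`, so `0 - 1 = n`.) -/
def IsCyclic {n : ℕ} (φ : Cochain B n) : Prop :=
  ∀ a : Fin (n + 1) → B, φ (fun k => a (k - 1)) = (-1 : ℂ) ^ n * φ a

/-- Cyclic `n`-cocycles: cyclic cochains with `bφ = 0`. -/
def IsCyclicCocycle {n : ℕ} (φ : Cochain B n) : Prop :=
  IsCyclic φ ∧ hochschildB φ = 0

/-- Connes' periodicity operator on cyclic cocycles,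
`Sφ = -∑_{i<j} (-1)^{i+j} φ ∘ dᵢ ∘ dⱼ`, normalized by `(Sτ)(a₀, a₁, a₂) = τ(a₀ a₁ a₂)` for a
trace `τ`. -/
def periodicityS {n : ℕ} (φ : Cochain B n) : Cochain B (n + 2) :=
  -∑ j : Fin (n + 3), ∑ i : Fin (n + 2),
    if (i : ℕ) < j then (-1 : ℂ) ^ ((i : ℕ) + j) • coface j (coface i φ) else 0

/-- Finite families `(φ₀, φ₂, φ₄, …)` of cochains of even degrees. -/
def EvenCochains (B : Type*) [Ring B] [Algebra ℂ B] : Type _ :=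
  Π₀ n : ℕ, Cochain B (2 * n)

instance (B : Type*) [Ring B] [Algebra ℂ B] : AddCommGroup (EvenCochains B) :=
  inferInstanceAs (AddCommGroup (Π₀ n : ℕ, Cochain B (2 * n)))

instance (B : Type*) [Ring B] [Algebra ℂ B] : Module ℂ (EvenCochains B) :=
  inferInstanceAs (Module ℂ (Π₀ n : ℕ, Cochain B (2 * n)))

/-- The component of degree `2n` of a family. -/
def EvenCochains.component (n : ℕ) : EvenCochains B →ₗ[ℂ] Cochain B (2 * n) :=
  DFinsupp.lapply (R := ℂ) (M := fun n => Cochain B (2 * n)) n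

/-- The family whose only non-zero component is `φ` in degree `2n`. -/
def EvenCochains.single (n : ℕ) : Cochain B (2 * n) →ₗ[ℂ] EvenCochains B :=
  DFinsupp.lsingle (R := ℂ) (M := fun n => Cochain B (2 * n)) n

theorem component_single (n : ℕ) (φ : Cochain B (2 * n)) :
    EvenCochains.component n (EvenCochains.single n φ) = φ :=
  DFinsupp.single_eq_same

theorem component_single_of_ne {m n : ℕ} (h : m ≠ n) (φ : Cochain B (2 * n)) :
    EvenCochains.component m (EvenCochains.single n φ) = 0 :=
  DFinsupp.single_eq_of_ne h

/-- The subspace of cyclic cocycles of degree `n`. -/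
def cyclicCocycles (B : Type*) [Ring B] [Algebra ℂ B] (n : ℕ) : Submodule ℂ (Cochain B n) where
  carrier := {φ | IsCyclicCocycle φ}
  add_mem' := by
    intro x y hx hy
    refine ⟨fun a => ?_, ?_⟩
    · rw [_root_.add_apply, _root_.add_apply, hx.1 a, hy.1 a, mul_add]
    · ext a
      have h1 := congrArg (fun f => f a) hx.2
      have h2 := congrArg (fun f => f a) hy.2
      simp only [hochschildB, _root_.sum_apply, _root_.smul_apply, coface_apply,
        _root_.zero_apply, _root_.add_apply, smul_add, Finset.sum_add_distrib] at h1 h2 ⊢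
      rw [h1, h2, add_zero]
  zero_mem' := by
    refine ⟨fun a => by simp, ?_⟩
    ext a
    simp [hochschildB]
  smul_mem' := by
    intro c x hx
    refine ⟨fun a => ?_, ?_⟩
    · rw [_root_.smul_apply, _root_.smul_apply, hx.1 a, smul_eq_mul, smul_eq_mul, mul_left_comm]
    · ext a
      have h1 := congrArg (fun f => f a) hx.2
      simp only [hochschildB, _root_.sum_apply, _root_.smul_apply, coface_apply,
        _root_.zero_apply] at h1 ⊢
      simp only [smul_comm _ c]
      rw [← Finset.smul_sum, h1, smul_zero]

/-- Finite families of cyclic cocycles of even degrees. -/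
def evenCyclicCocycles (B : Type*) [Ring B] [Algebra ℂ B] : Submodule ℂ (EvenCochains B) :=
  ⨅ n : ℕ, (cyclicCocycles B (2 * n)).comap (EvenCochains.component n)

/-- The relations that define `HC^{even}`: coboundaries of cyclic cochains vanish, and a cyclic
cocycle `φ` is identified with `Sφ`. -/
def evenRelations (B : Type*) [Ring B] [Algebra ℂ B] : Submodule ℂ (EvenCochains B) :=
  Submodule.span ℂ
    ({z | ∃ (n : ℕ) (ψ : Cochain B (2 * n + 1)), IsCyclic ψ ∧
        z = EvenCochains.single (n + 1) (hochschildB ψ)} ∪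
     {z | ∃ (n : ℕ) (φ : Cochain B (2 * n)), IsCyclicCocycle φ ∧
        z = EvenCochains.single n φ - EvenCochains.single (n + 1) (periodicityS φ)})

/-- `HC^{even}(B)`, the inductive limit of the cyclic cohomology groups
`HC^{0}(B) → HC^{2}(B) → HC^{4}(B) → ⋯` along the periodicity operator `S`. -/
abbrev HCeven (B : Type*) [Ring B] [Algebra ℂ B] : Type _ :=
  evenCyclicCocycles B ⧸ (evenRelations B).comap (evenCyclicCocycles B).subtype

theorem single_mem {n : ℕ} {φ : Cochain B (2 * n)} (h : IsCyclicCocycle φ) :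
    EvenCochains.single n φ ∈ evenCyclicCocycles B := by
  simp only [evenCyclicCocycles, Submodule.mem_iInf, Submodule.mem_comap]
  intro m
  by_cases hm : m = n
  · subst hm
    rw [component_single]
    exact h
  · rw [component_single_of_ne hm]
    exact zero_mem _

/-- The class in `HC^{even}(B)` of a cyclic cocycle of degree `2n`. -/
def HCeven.mk {n : ℕ} (φ : Cochain B (2 * n)) (h : IsCyclicCocycle φ) : HCeven B :=
  Submodule.Quotient.mk ⟨_, single_mem h⟩

/-! ## The pairing of idempotent matrices with `HC^{even}` -/

/-- The cochain `φ # Tr` on matrices: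
`(φ # Tr)(A₀, …, Aₙ) = ∑ φ((A₀)_{i₀ i₁}, (A₁)_{i₁ i₂}, …, (Aₙ)_{iₙ i₀})`. -/
def matrixExt (ι : Type*) [Fintype ι] [DecidableEq ι] {n : ℕ} (φ : Cochain B n) :
    Cochain (Matrix ι ι B) n :=
  ∑ i : Fin (n + 1) → ι,
    φ.compLinearMap fun k => Matrix.entryLinearMap ℂ B (i k) (i (k + 1))

section MatrixExt

variable {ι κ : Type*} [Fintype ι] [DecidableEq ι] [Fintype κ] [DecidableEq κ]

theorem matrixExt_apply {n : ℕ} (φ : Cochain B n) (A : Fin (n + 1) → Matrix ι ι B) :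
    matrixExt ι φ A = ∑ i : Fin (n + 1) → ι, φ fun k => A k (i k) (i (k + 1)) := by
  simp [matrixExt]

theorem matrixExt_rot {n : ℕ} (φ : Cochain B n) (A : Fin (n + 1) → Matrix ι ι B) :
    matrixExt ι φ (fun k => A (k - 1)) =
      ∑ i : Fin (n + 1) → ι, φ fun k => A (k - 1) (i (k - 1)) (i (k - 1 + 1)) := by
  rw [matrixExt_apply]
  refine Fintype.sum_equiv (Equiv.arrowCongr (Equiv.subRight (1 : Fin (n + 1))) (Equiv.refl ι))
    _ _ fun i => ?_
  congr 1
  funext k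
  simp

theorem matrixExt_isCyclic {n : ℕ} {φ : Cochain B n} (h : IsCyclic φ) :
    IsCyclic (matrixExt ι φ) := by
  intro A
  rw [matrixExt_rot, matrixExt_apply, Finset.mul_sum]
  refine Finset.sum_congr rfl fun i _ => ?_
  exact h fun k => A k (i k) (i (k + 1))

theorem face_last_eq {C : Type*} [Ring C] {n : ℕ} (a : Fin (n + 2) → C) :
    face (Fin.last (n + 1)) a = face 0 (fun k => a (k - 1)) := by
  funext k
  by_cases hk : k = 0
  · subst hk
    have h0 : (0 : Fin (n + 2)) ≠ Fin.last (n + 1) := by simp [Fin.ext_iff]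
    have : (0 : Fin (n + 2)) - 1 = Fin.last (n + 1) := by
      rw [sub_eq_iff_eq_add]; simp
    simp [face, h0, Fin.contractNth, this]
  · have hk' : (k : ℕ) ≠ 0 := fun h => hk (Fin.ext h)
    have h0 : (0 : Fin (n + 2)) ≠ Fin.last (n + 1) := by simp [Fin.ext_iff]
    have h1 : (k.succ - 1 : Fin (n + 2)) = k.castSucc := by
      rw [sub_eq_iff_eq_add]; simp
    have : (k : ℕ) < n + 1 := k.2
    simp [face, hk, h0, Fin.contractNth, h1, this]

theorem matrixExt_coface_castSucc {n : ℕ} (φ : Cochain B n) (j : Fin (n + 1)) :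
    matrixExt ι (coface j.castSucc φ) = coface j.castSucc (matrixExt ι φ) := by
  refine MultilinearMap.ext fun A => ?_
  rw [coface_apply, matrixExt_apply, matrixExt_apply]
  have hj : j.castSucc ≠ Fin.last (n + 1) := (Fin.castSucc_lt_last j).ne
  rw [← (Fin.insertNthEquiv (fun _ => ι) j.succ).sum_comp, Fintype.sum_prod_type_right]
  refine Finset.sum_congr rfl fun i _ => ?_
  have hR : (fun k => face j.castSucc A k (i k) (i (k + 1))) =
      Function.update (fun k => face j.castSucc A k (i k) (i (k + 1))) j
        (∑ r, A j.castSucc (i j) r * A j.succ r (i (j + 1))) := by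
    funext k
    by_cases hk : k = j
    · subst hk
      simp [face, hj, Fin.contractNth, Matrix.mul_apply]
    · simp [hk]
  rw [hR, MultilinearMap.map_update_sum]
  refine Finset.sum_congr rfl fun r _ => ?_
  rw [coface_apply]
  congr 1
  have hle : ∀ k : Fin (n + 1), k ≤ j →
      (j.succ.insertNth r i : Fin (n + 2) → ι) k.castSucc = i k := by
    intro k hk
    have : j.succ.succAbove k = k.castSucc :=
      Fin.succAbove_of_castSucc_lt _ _ (by simpa [Fin.lt_def, Nat.lt_succ_iff] using hk)
    rw [← this, Fin.insertNth_apply_succAbove]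
  have hgt : ∀ k : Fin (n + 1), j < k →
      (j.succ.insertNth r i : Fin (n + 2) → ι) k.succ = i k := by
    intro k hk
    have : j.succ.succAbove k = k.succ :=
      Fin.succAbove_of_le_castSucc _ _ (by simpa [Fin.le_def, Nat.succ_le_iff] using hk)
    rw [← this, Fin.insertNth_apply_succAbove]
  have hnext : ∀ k : Fin (n + 1), j ≤ k →
      (j.succ.insertNth r i : Fin (n + 2) → ι) (k.succ + 1) = i (k + 1) := by
    intro k hk
    induction k using Fin.lastCases with
    | last =>
      have h1 : (Fin.last n).succ + 1 = (0 : Fin (n + 1)).castSucc := by simp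
      rw [h1, hle 0 (Fin.zero_le _)]; simp
    | cast k =>
      have h1 : k.castSucc.succ + 1 = (k.succ).succ := by
        apply Fin.ext; simp [Fin.val_add]
      have h2 : k.castSucc + 1 = k.succ := by simp
      rw [h1, h2, hgt]
      exact lt_of_le_of_lt hk (Fin.castSucc_lt_succ)
  funext k
  simp only [Fin.insertNthEquiv_apply]
  rcases lt_trichotomy k j with hk | hk | hk
  · have hk' : (k : ℕ) < j := hk
    have h1 : k.castSucc + 1 = (k + 1).castSucc := by
      apply Fin.ext
      have := j.2
      rw [Fin.val_add_one_of_lt' (by simp; omega), Fin.val_castSucc, Fin.val_castSucc,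
        Fin.val_add_one_of_lt' (by omega)]
    have h2 : k + 1 ≤ j := by
      rw [Fin.le_def, Fin.val_add_one_of_lt' (by omega)]; omega
    simp [face, hj, Fin.contractNth, hk, hk.ne, h1, hle _ hk.le, hle _ h2]
  · subst hk
    have h1 : k.castSucc + 1 = k.succ := by simp
    simp [face, hj, Fin.contractNth, hle _ le_rfl, hnext _ le_rfl]
  · have hk' : (j : ℕ) < k := hk
    simp [face, hj, Fin.contractNth, hk.not_gt, hk'.ne', hk.ne', hgt _ hk, hnext _ hk.le]

theorem matrixExt_coface {n : ℕ} (φ : Cochain B n) (j : Fin (n + 2)) :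
    matrixExt ι (coface j φ) = coface j (matrixExt ι φ) := by
  induction j using Fin.lastCases with
  | cast j => exact matrixExt_coface_castSucc φ j
  | last =>
    have h0 := matrixExt_coface_castSucc (ι := ι) φ 0
    rw [Fin.castSucc_zero] at h0
    refine MultilinearMap.ext fun A => ?_
    rw [coface_apply, face_last_eq, ← coface_apply, ← h0, matrixExt_rot, matrixExt_apply]
    refine Finset.sum_congr rfl fun i _ => ?_
    rw [coface_apply, coface_apply, face_last_eq]

theorem matrixExt_add {n : ℕ} (φ ψ : Cochain B n) :
    matrixExt ι (φ + ψ) = matrixExt ι φ + matrixExt ι ψ := by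
  refine MultilinearMap.ext fun A => ?_
  simp [matrixExt_apply, Finset.sum_add_distrib]

theorem matrixExt_smul {n : ℕ} (c : ℂ) (φ : Cochain B n) :
    matrixExt ι (c • φ) = c • matrixExt ι φ := by
  refine MultilinearMap.ext fun A => ?_
  simp [matrixExt_apply, Finset.mul_sum]

/-- `φ ↦ φ # Tr` as a linear map. -/
def matrixExtₗ (ι : Type*) [Fintype ι] [DecidableEq ι] (n : ℕ) :
    Cochain B n →ₗ[ℂ] Cochain (Matrix ι ι B) n where
  toFun := matrixExt ι
  map_add' := matrixExt_add
  map_smul' := matrixExt_smul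

theorem matrixExt_hochschildB {n : ℕ} (φ : Cochain B n) :
    matrixExt ι (hochschildB φ) = hochschildB (matrixExt ι φ) := by
  change matrixExtₗ ι _ _ = _
  simp only [hochschildB, map_sum, map_smul]
  exact Finset.sum_congr rfl fun i _ => by rw [← matrixExt_coface]; rfl

theorem matrixExt_isCyclicCocycle {n : ℕ} {φ : Cochain B n} (h : IsCyclicCocycle φ) :
    IsCyclicCocycle (matrixExt ι φ) :=
  ⟨matrixExt_isCyclic h.1, by
    rw [← matrixExt_hochschildB, h.2]; exact (matrixExtₗ ι (n + 1)).map_zero⟩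

theorem matrixExt_periodicityS {n : ℕ} (φ : Cochain B n) :
    matrixExt ι (periodicityS φ) = periodicityS (matrixExt ι φ) := by
  change matrixExtₗ ι _ _ = _
  simp only [periodicityS, map_neg, map_sum]
  congr 1
  refine Finset.sum_congr rfl fun j _ => Finset.sum_congr rfl fun i _ => ?_
  split_ifs
  · rw [map_smul, ← matrixExt_coface, ← matrixExt_coface]; rfl
  · exact map_zero _

theorem matrixExt_fromBlocks {n : ℕ} (φ : Cochain B n) (e : Matrix ι ι B) (f : Matrix κ κ B) :
    matrixExt (ι ⊕ κ) φ (fun _ => Matrix.fromBlocks e 0 0 f) =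
      matrixExt ι φ (fun _ => e) + matrixExt κ φ (fun _ => f) := by
  rw [matrixExt_apply, matrixExt_apply, matrixExt_apply]
  have hs := Fintype.sum_sum_type fun s : (Fin (n + 1) → ι) ⊕ (Fin (n + 1) → κ) => Sum.elim
    (fun i : Fin (n + 1) → ι => φ fun k => e (i k) (i (k + 1)))
    (fun i : Fin (n + 1) → κ => φ fun k => f (i k) (i (k + 1))) s
  simp only [Sum.elim_inl, Sum.elim_inr] at hs
  refine Eq.trans ?_ hs
  symm
  refine Fintype.sum_of_injective
    (Sum.elim (fun i k => Sum.inl (i k)) (fun i k => Sum.inr (i k))) ?_ _ _ ?_ ?_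
  · rintro (i | i) (j | j) h
    · congr 1; funext k; simpa using congrFun h k
    · simpa using congrFun h 0
    · simpa using congrFun h 0
    · congr 1; funext k; simpa using congrFun h k
  · intro i hi
    by_contra hne
    have key : ∀ k, (i k).isLeft = (i (k + 1)).isLeft := by
      intro k
      by_contra hk
      apply hne
      refine φ.map_coord_zero k ?_
      cases h1 : i k <;> cases h2 : i (k + 1) <;> simp_all
    have key2 : ∀ k, (i k).isLeft = (i 0).isLeft := by
      intro k
      induction k using Fin.induction with
      | zero => rfl
      | succ k ih => rw [← ih, key k.castSucc]; simp
    apply hi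
    cases h0 : i 0 with
    | inl x =>
      have : ∀ k, ∃ y, i k = Sum.inl y := fun k => by
        have := key2 k
        rw [h0] at this
        exact Sum.isLeft_iff.1 (by simpa using this)
      choose y hy using this
      exact ⟨Sum.inl y, by funext k; simp [hy]⟩
    | inr x =>
      have : ∀ k, ∃ y, i k = Sum.inr y := fun k => by
        have := key2 k
        rw [h0] at this
        exact Sum.isRight_iff.1 (by simpa using this)
      choose y hy using this
      exact ⟨Sum.inr y, by funext k; simp [hy]⟩
  · rintro (i | i) <;> simp

theorem matrixExt_reindex {n : ℕ} (φ : Cochain B n) (s : ι ≃ κ) (e : Matrix ι ι B) :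
    matrixExt κ φ (fun _ => Matrix.reindex s s e) = matrixExt ι φ (fun _ => e) := by
  rw [matrixExt_apply, matrixExt_apply]
  refine Fintype.sum_equiv (Equiv.arrowCongr (Equiv.refl _) s.symm) _ _ fun i => ?_
  congr 1

end MatrixExt

section Idempotent

theorem face_const {C : Type*} [Ring C] {e : C} (he : e * e = e) {n : ℕ} (i : Fin (n + 2)) :
    face i (fun _ => e) = fun _ => e := by
  funext k
  simp [face, Fin.contractNth, he]

variable {C : Type*} [Ring C] [Algebra ℂ C]

theorem sum_neg_one_odd (n : ℕ) : ∑ i : Fin (2 * n + 1), (-1 : ℂ) ^ (i : ℕ) = 1 := by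
  rw [Fin.sum_univ_eq_sum_range (fun i => (-1 : ℂ) ^ i), neg_one_geom_sum]
  simp

theorem hochschildB_idem {n : ℕ} {ψ : Cochain C (2 * n + 1)} (h : IsCyclic ψ) {e : C}
    (he : e * e = e) : hochschildB ψ (fun _ => e) = 0 := by
  have h1 : ψ (fun _ => e) = 0 := by
    have := h fun _ => e
    rw [pow_succ, pow_mul] at this
    norm_num at this
    exact self_eq_neg.1 this
  simp [hochschildB, _root_.sum_apply, face_const he, h1]

theorem sum_neg_one_pairs (n : ℕ) :
    -∑ j : Fin (2 * n + 3), ∑ i : Fin (2 * n + 2),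
      (if (i : ℕ) < j then (-1 : ℂ) ^ ((i : ℕ) + j) else 0) = n + 1 := by
  have h1 : ∀ j : Fin (2 * n + 3), ∑ i : Fin (2 * n + 2),
      (if (i : ℕ) < j then (-1 : ℂ) ^ ((i : ℕ) + j) else 0) = ((-1) ^ (j : ℕ) - 1) / 2 := by
    intro j
    rw [Fin.sum_univ_eq_sum_range (fun i => if i < (j : ℕ) then (-1 : ℂ) ^ (i + (j : ℕ)) else 0),
      ← Finset.sum_filter]
    have : (Finset.range (2 * n + 2)).filter (fun i => i < (j : ℕ)) = Finset.range j := by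
      ext i
      have := j.2
      simp only [Finset.mem_filter, Finset.mem_range]
      omega
    rw [this]
    simp only [pow_add]
    rw [← Finset.sum_mul, neg_one_geom_sum]
    rcases Nat.even_or_odd (j : ℕ) with h | h
    · simp [h]
    · simp [Nat.not_even_iff_odd.2 h, h.neg_one_pow]; norm_num
  simp only [h1]
  have h2 := sum_neg_one_odd (n + 1)
  change ∑ i : Fin (2 * n + 3), (-1 : ℂ) ^ (i : ℕ) = 1 at h2
  rw [← Finset.sum_div, Finset.sum_sub_distrib, h2]
  simp
  ring

theorem periodicityS_idem {n : ℕ} (φ : Cochain C (2 * n)) {e : C} (he : e * e = e) :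
    periodicityS φ (fun _ => e) = (n + 1) * φ (fun _ => e) := by
  rw [← sum_neg_one_pairs n]
  simp only [periodicityS, _root_.neg_apply, _root_.sum_apply, neg_mul, Finset.sum_mul]
  congr 1
  refine Finset.sum_congr rfl fun j _ => Finset.sum_congr rfl fun i _ => ?_
  split_ifs <;> simp [face_const he]

end Idempotent
section Homotopy

variable {C : Type*} [Ring C] [Algebra ℂ C]

theorem cocycle_commutator {n : ℕ} {Φ : Cochain C (2 * n)} (h : hochschildB Φ = 0) {p : C}
    (hp : p * p = p) (N : C) :
    Φ (Function.update (fun _ => p) 0 (N * p - p * N)) = 0 := by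
  have h1 := congrArg (fun f => f (Function.update (fun _ => p) 0 N)) h
  simp only [hochschildB, _root_.sum_apply, _root_.smul_apply, coface_apply,
    _root_.zero_apply, smul_eq_mul] at h1
  have hlast : face (Fin.last (2 * n + 1)) (Function.update (fun _ => p) 0 N) =
      Function.update (fun _ => p) 0 (p * N) := by
    funext k
    by_cases hk : k = 0
    · subst hk; simp [face, Function.update, Fin.ext_iff]
    · have : (k : ℕ) < 2 * n + 1 := k.2
      simp [face, hk, Fin.contractNth, this]
  have hzero : face (0 : Fin (2 * n + 2)) (Function.update (fun _ => p) 0 N) =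
      Function.update (fun _ => p) 0 (N * p) := by
    funext k
    by_cases hk : k = 0
    · subst hk; simp [face, Fin.contractNth]
    · simp [face, hk, Fin.contractNth]
  have hmid : ∀ i : Fin (2 * n), face (i.succ.castSucc) (Function.update (fun _ => p) 0 N) =
      Function.update (fun _ => p) 0 N := by
    intro i
    funext k
    by_cases hk : k = 0
    · subst hk; simp [face, Fin.contractNth]
    · simp [face, hk, Fin.contractNth, hp]
  rw [Fin.sum_univ_castSucc, Fin.sum_univ_succ] at h1
  simp only [hlast, Fin.castSucc_zero, hzero, hmid] at h1
  rw [← Finset.sum_mul] at h1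
  have hs : ∑ i : Fin (2 * n), (-1 : ℂ) ^ ((i.succ.castSucc : Fin (2 * n + 1 + 1)) : ℕ) = 0 := by
    simp only [Fin.val_castSucc, Fin.val_succ, pow_succ]
    rw [← Finset.sum_mul, Fin.sum_univ_eq_sum_range (fun i => (-1 : ℂ) ^ i), neg_one_geom_sum]
    simp
  rw [hs] at h1
  have h2 : (-1 : ℂ) ^ ((Fin.last (2 * n + 1) : Fin (2 * n + 1 + 1)) : ℕ) = -1 := by
    simp [pow_succ, pow_mul]
  rw [h2] at h1
  rw [MultilinearMap.map_update_sub]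
  simpa [sub_eq_add_neg] using h1

theorem cyclic_update {n : ℕ} {Φ : Cochain C (2 * n)} (h : IsCyclic Φ) (p x : C)
    (k : Fin (2 * n + 1)) :
    Φ (Function.update (fun _ => p) k x) = Φ (Function.update (fun _ => p) 0 x) := by
  induction k using Fin.induction with
  | zero => rfl
  | succ k ih =>
    rw [← ih]
    have h1 := h (Function.update (fun _ => p) k.castSucc x)
    rw [pow_mul] at h1
    norm_num at h1
    rw [← h1]
    congr 1
    funext j
    have : j - 1 = k.castSucc ↔ j = k.succ := by
      rw [sub_eq_iff_eq_add]; simp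
    simp only [Function.update_apply, this]

theorem multilinear_hasDerivAt {m d : ℕ} (Φ : MultilinearMap ℂ (fun _ : Fin m => C) ℂ)
    (v : Fin d → C) (w w' : Fin d → ℂ → ℂ) (s : ℂ) (hw : ∀ j, HasDerivAt (w j) (w' j s) s) :
    HasDerivAt (fun s => Φ fun _ => ∑ j, w j s • v j)
      (∑ k : Fin m, Φ (Function.update (fun _ => ∑ j, w j s • v j) k (∑ j, w' j s • v j))) s := by
  let L : (Fin d → ℂ) →ₗ[ℂ] C := Fintype.linearCombination ℂ v
  let Ψ : MultilinearMap ℂ (fun _ : Fin m => (Fin d → ℂ)) ℂ := Φ.compLinearMap fun _ => L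
  have hcont : Continuous Ψ := by
    have : (Ψ : (Fin m → Fin d → ℂ) → ℂ) = fun a =>
        ∑ r : Fin m → Fin d, (∏ k, a k (r k)) * Φ fun k => v (r k) := by
      funext a
      simp only [Ψ, L, MultilinearMap.compLinearMap_apply, Fintype.linearCombination_apply]
      rw [MultilinearMap.map_sum]
      exact Finset.sum_congr rfl fun r _ => by rw [MultilinearMap.map_smul_univ, smul_eq_mul]
    rw [this]
    fun_prop
  let Ψc : ContinuousMultilinearMap ℂ (fun _ : Fin m => (Fin d → ℂ)) ℂ := ⟨Ψ, hcont⟩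
  have hγ : HasDerivAt (fun s => (fun (_ : Fin m) (j : Fin d) => w j s))
      (fun (_ : Fin m) (j : Fin d) => w' j s) s :=
    hasDerivAt_pi.2 fun _ => hasDerivAt_pi.2 hw
  have := (Ψc.hasFDerivAt (x := fun _ j => w j s)).comp_hasDerivAt s hγ
  convert! this using 1
  rw [ContinuousMultilinearMap.linearDeriv_apply]
  refine Finset.sum_congr rfl fun k _ => ?_
  change _ = Φ _
  congr 1
  funext l
  by_cases hl : l = k
  · subst hl; simp [L, Fintype.linearCombination_apply]
  · simp [hl, L, Fintype.linearCombination_apply]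

/-- A cyclic cocycle of even degree takes the same value on two orthogonal equivalent
idempotents. -/
theorem cocycle_equiv_orthogonal {n : ℕ} {Φ : Cochain C (2 * n)} (h : IsCyclicCocycle Φ)
    {E F X Y : C} (hE : E * E = E) (hF : F * F = F) (hEF : E * F = 0) (hFE : F * E = 0)
    (hXY : X * Y = E) (hYX : Y * X = F) (hEX : E * X = X) (hXF : X * F = X) (hFY : F * Y = Y)
    (hYE : Y * E = Y) : Φ (fun _ => E) = Φ (fun _ => F) := by
  have hXE : X * E = 0 := by rw [← hXF, mul_assoc, hFE, mul_zero]
  have hFX : F * X = 0 := by rw [← hEX, ← mul_assoc, hFE, zero_mul]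
  have hEY : E * Y = 0 := by rw [← hFY, ← mul_assoc, hEF, zero_mul]
  have hYF : Y * F = 0 := by rw [← hYE, mul_assoc, hEF, mul_zero]
  have hXX : X * X = 0 := by
    nth_rewrite 1 [← hXF]
    rw [mul_assoc, hFX, mul_zero]
  have hYY : Y * Y = 0 := by
    nth_rewrite 1 [← hYE]
    rw [mul_assoc, hEY, mul_zero]
  let v : Fin 3 → C := ![E, X + Y, F]
  let w : Fin 3 → ℂ → ℂ := ![fun s => Complex.cos s * Complex.cos s,
    fun s => Complex.cos s * Complex.sin s, fun s => Complex.sin s * Complex.sin s]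
  let w' : Fin 3 → ℂ → ℂ := ![fun s => -(2 * (Complex.cos s * Complex.sin s)),
    fun s => Complex.cos s * Complex.cos s - Complex.sin s * Complex.sin s,
    fun s => 2 * (Complex.cos s * Complex.sin s)]
  have hw : ∀ s j, HasDerivAt (w j) (w' j s) s := by
    intro s j
    have hc := Complex.hasDerivAt_cos s
    have hs := Complex.hasDerivAt_sin s
    fin_cases j
    · refine (hc.mul hc).congr_deriv ?_; simp [w']; ring
    · refine (hc.mul hs).congr_deriv ?_; simp [w']; ring
    · refine (hs.mul hs).congr_deriv ?_; simp [w']; ring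
  have hder : ∀ s, HasDerivAt (fun s => Φ fun _ => ∑ j, w j s • v j) 0 s := by
    intro s
    refine (multilinear_hasDerivAt Φ v w w' s (hw s)).congr_deriv ?_
    refine Finset.sum_eq_zero fun k _ => ?_
    rw [cyclic_update h.1]
    set c := Complex.cos s with hc
    set t := Complex.sin s with ht
    have hct : c * c + t * t = 1 := by
      have := Complex.cos_sq_add_sin_sq s
      rw [← hc, ← ht] at this
      linear_combination this
    have hP : ∑ j, w j s • v j = (c * c) • E + (c * t) • (X + Y) + (t * t) • F := by
      simp [Fin.sum_univ_three, w, v, ← hc, ← ht]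
    have hP' : ∑ j, w' j s • v j =
        (-(2 * (c * t))) • E + (c * c - t * t) • (X + Y) + (2 * (c * t)) • F := by
      simp [Fin.sum_univ_three, w', v, ← hc, ← ht]
    have hcomm : ∑ j, w' j s • v j =
        (Y - X) * (∑ j, w j s • v j) - (∑ j, w j s • v j) * (Y - X) := by
      rw [hP, hP']
      simp only [mul_add, add_mul, sub_mul, mul_sub, mul_smul_comm, smul_mul_assoc, hEX, hXF, hFY,
        hYE, hXE, hFX, hEY, hYF, hXX, hYY, hXY, hYX]
      module
    rw [hcomm]
    refine cocycle_commutator h.2 ?_ _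
    rw [hP]
    simp only [mul_add, add_mul, mul_smul_comm, smul_mul_assoc, hEX, hXF, hFY,
      hYE, hXE, hFX, hEY, hYF, hXX, hYY, hXY, hYX, hE, hF, hEF, hFE]
    have hc2 : c * c = 1 - t * t := by linear_combination hct
    match_scalars
    · linear_combination (c * c) * hct
    · linear_combination (c * t) * hct
    · linear_combination (c * t) * hct
    · linear_combination (t * t) * hct
  have hconst := is_const_of_deriv_eq_zero (fun s => (hder s).differentiableAt)
    (fun s => (hder s).deriv) 0 (Real.pi / 2 : ℂ)
  simpa [Fin.sum_univ_three, w, v] using hconst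

end Homotopy

section MatrixExt

variable {ι κ : Type*} [Fintype ι] [DecidableEq ι] [Fintype κ] [DecidableEq κ]

theorem matrixExt_zero_idem {n : ℕ} (φ : Cochain B n) :
    matrixExt ι φ (fun _ => 0) = 0 :=
  (matrixExt ι φ).map_coord_zero (0 : Fin (n + 1)) rfl

/-- The value `(φ # Tr)(e, …, e)` depends only on the equivalence class of the idempotent `e`. -/
theorem matrixExt_equiv {n : ℕ} {φ : Cochain B (2 * n)} (h : IsCyclicCocycle φ)
    {e : Matrix ι ι B} {f : Matrix κ κ B} (he : e * e = e) (hf : f * f = f)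
    {x : Matrix ι κ B} {y : Matrix κ ι B} (hxy : x * y = e) (hyx : y * x = f) :
    matrixExt ι φ (fun _ => e) = matrixExt κ φ (fun _ => f) := by
  have hxf : x * f = e * x := by rw [← hyx, ← hxy, Matrix.mul_assoc]
  have hye : y * e = f * y := by rw [← hyx, ← hxy, Matrix.mul_assoc]
  have hexf : e * x * f = e * x := by rw [Matrix.mul_assoc, hxf, ← Matrix.mul_assoc, he]
  have hfye : f * y * e = f * y := by rw [Matrix.mul_assoc, hye, ← Matrix.mul_assoc, hf]
  have hxy' : e * x * (f * y) = e := by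
    rw [← Matrix.mul_assoc, hexf, Matrix.mul_assoc, hxy, he]
  have hyx' : f * y * (e * x) = f := by
    rw [← Matrix.mul_assoc, hfye, Matrix.mul_assoc, hyx, hf]
  have hex : e * (e * x) = e * x := by rw [← Matrix.mul_assoc, he]
  have hfy : f * (f * y) = f * y := by rw [← Matrix.mul_assoc, hf]
  have key := cocycle_equiv_orthogonal (matrixExt_isCyclicCocycle (ι := ι ⊕ κ) h)
    (E := Matrix.fromBlocks e 0 0 0) (F := Matrix.fromBlocks 0 0 0 f)
    (X := Matrix.fromBlocks 0 (e * x) 0 0) (Y := Matrix.fromBlocks 0 0 (f * y) 0)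
    (by simp [Matrix.fromBlocks_multiply, he]) (by simp [Matrix.fromBlocks_multiply, hf])
    (by simp [Matrix.fromBlocks_multiply]) (by simp [Matrix.fromBlocks_multiply])
    (by simp only [Matrix.fromBlocks_multiply, hxy']; simp)
    (by simp only [Matrix.fromBlocks_multiply, hyx']; simp)
    (by simp only [Matrix.fromBlocks_multiply, hex]; simp)
    (by simp only [Matrix.fromBlocks_multiply, hexf]; simp)
    (by simp only [Matrix.fromBlocks_multiply, hfy]; simp)
    (by simp only [Matrix.fromBlocks_multiply, hfye]; simp)
  rw [matrixExt_fromBlocks, matrixExt_fromBlocks, matrixExt_zero_idem, matrixExt_zero_idem,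
    add_zero, zero_add] at key
  exact key

end MatrixExt

/-! ## The group `K₀` and the Chern–Connes pairing -/

/-- Idempotent matrices over `B`, of arbitrary finite size. -/
structure IdemMatrix (B : Type*) [Ring B] where
  /-- the size -/
  size : ℕ
  /-- the matrix -/
  mat : Matrix (Fin size) (Fin size) B
  /-- the matrix is idempotent -/
  idem : mat * mat = mat

/-- The direct sum of idempotent matrices, `e ⊕ f = [[e, 0], [0, f]]`. -/
def IdemMatrix.sum {B : Type*} [Ring B] (e f : IdemMatrix B) : IdemMatrix B where
  size := e.size + f.size
  mat := Matrix.reindex finSumFinEquiv finSumFinEquiv (Matrix.fromBlocks e.mat 0 0 f.mat)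
  idem := by
    simp [Matrix.submatrix_mul_equiv, Matrix.fromBlocks_multiply, e.idem, f.idem]

/-- Equivalence of idempotents: `e = x y` and `f = y x` for rectangular matrices `x`, `y`. -/
def IdemMatrix.Equivalent {B : Type*} [Ring B] (e f : IdemMatrix B) : Prop :=
  ∃ (x : Matrix (Fin e.size) (Fin f.size) B) (y : Matrix (Fin f.size) (Fin e.size) B),
    x * y = e.mat ∧ y * x = f.mat

/-- The relations `[e] = [f]` for equivalent idempotents and `[e ⊕ f] = [e] + [f]`. -/
def K0Relations (B : Type*) [Ring B] : AddSubgroup (FreeAbelianGroup (IdemMatrix B)) :=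
  AddSubgroup.closure
    ({z | ∃ e f : IdemMatrix B, e.Equivalent f ∧
        z = FreeAbelianGroup.of e - FreeAbelianGroup.of f} ∪
     {z | ∃ e f : IdemMatrix B,
        z = FreeAbelianGroup.of (e.sum f) - (FreeAbelianGroup.of e + FreeAbelianGroup.of f)})

/-- The algebraic group `K₀(B)`: the Grothendieck group of the monoid of equivalence classes of
idempotent matrices over `B` under direct sum. -/
abbrev K0 (B : Type*) [Ring B] : Type _ :=
  FreeAbelianGroup (IdemMatrix B) ⧸ K0Relations B

/-- The idempotent `1 × 1` matrix with entry `e`. -/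
def IdemMatrix.ofIdem {B : Type*} [Ring B] (e : B) (he : IsIdempotentElem e) : IdemMatrix B where
  size := 1
  mat := Matrix.of fun _ _ => e
  idem := by
    ext i j
    simpa [Matrix.mul_apply] using he.eq

/-- The class `[e] ∈ K₀(B)` of an idempotent `e ∈ B`. -/
def K0.mk {B : Type*} [Ring B] (e : B) (he : IsIdempotentElem e) : K0 B :=
  QuotientAddGroup.mk (FreeAbelianGroup.of (IdemMatrix.ofIdem e he))

/-- `φ ↦ (1 / n!) (φ # Tr)(e, …, e)` for `φ` of degree `2n`. -/
def chernTerm (e : IdemMatrix B) (n : ℕ) : Cochain B (2 * n) →ₗ[ℂ] ℂ where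
  toFun φ := 1 / (n.factorial : ℂ) * matrixExt (Fin e.size) φ fun _ => e.mat
  map_add' φ ψ := by rw [matrixExt_add, _root_.add_apply, mul_add]
  map_smul' c φ := by
    rw [matrixExt_smul, _root_.smul_apply, smul_eq_mul, mul_left_comm, RingHom.id_apply,
      smul_eq_mul]

/-- `(φ₀, φ₂, …) ↦ ∑ₙ (1 / n!) (φ₂ₙ # Tr)(e, …, e)`. -/
def chernNumber (e : IdemMatrix B) : EvenCochains B →ₗ[ℂ] ℂ :=
  DFinsupp.lsum ℂ (M := fun n => Cochain B (2 * n)) (chernTerm e)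

theorem chernNumber_single (e : IdemMatrix B) (n : ℕ) (φ : Cochain B (2 * n)) :
    chernNumber e (EvenCochains.single n φ) =
      1 / (n.factorial : ℂ) * matrixExt (Fin e.size) φ fun _ => e.mat :=
  DFinsupp.lsum_single (R := ℂ) ℂ (M := fun n => Cochain B (2 * n)) (chernTerm e) n φ

theorem chernNumber_relations (e : IdemMatrix B) :
    evenRelations B ≤ LinearMap.ker (chernNumber e) := by
  refine Submodule.span_le.2 ?_
  rintro z (⟨n, ψ, hψ, rfl⟩ | ⟨n, φ, -, rfl⟩)
  · rw [SetLike.mem_coe, LinearMap.mem_ker]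
    have := hochschildB_idem (n := n) (matrixExt_isCyclic (ι := Fin e.size) hψ) e.idem
    refine (chernNumber_single e (n + 1) (hochschildB ψ)).trans ?_
    rw [matrixExt_hochschildB]
    exact mul_eq_zero_of_right _ this
  · rw [SetLike.mem_coe, LinearMap.mem_ker, map_sub, chernNumber_single, sub_eq_zero]
    refine Eq.symm ((chernNumber_single e (n + 1) (periodicityS φ)).trans ?_)
    rw [matrixExt_periodicityS]
    refine (congrArg _ (periodicityS_idem (matrixExt (Fin e.size) φ) e.idem)).trans ?_
    rw [Nat.factorial_succ, Nat.cast_mul, ← mul_assoc]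
    have h1 : ((n + 1 : ℕ) : ℂ) ≠ 0 := by exact_mod_cast n.succ_ne_zero
    have h2 : (n.factorial : ℂ) ≠ 0 := by exact_mod_cast n.factorial_ne_zero
    congr 1
    push_cast at h1 ⊢
    field_simp

theorem chernNumber_congr {e f : IdemMatrix B} (z : evenCyclicCocycles B)
    (h : ∀ (n : ℕ) (φ : Cochain B (2 * n)), IsCyclicCocycle φ →
      chernTerm e n φ = chernTerm f n φ) :
    chernNumber e (z : EvenCochains B) = chernNumber f (z : EvenCochains B) := by
  classical
  obtain ⟨z, hz⟩ := z
  simp only [evenCyclicCocycles, Submodule.mem_iInf, Submodule.mem_comap] at hz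
  change DFinsupp.sumAddHom (fun n => (chernTerm e n).toAddMonoidHom) z =
    DFinsupp.sumAddHom (fun n => (chernTerm f n).toAddMonoidHom) z
  refine (DFinsupp.sumAddHom_apply _ _).trans (Eq.trans ?_ (DFinsupp.sumAddHom_apply _ _).symm)
  exact Finset.sum_congr rfl fun n _ => h n _ (hz n)

/-- The pairing of an idempotent matrix with `HC^{even}(B)`, induced by
`⟨e, φ⟩ = (1 / n!) (φ # Tr)(e, …, e)` on cyclic cocycles of degree `2n`. -/
def idemPairing (e : IdemMatrix B) : HCeven B →ₗ[ℂ] ℂ :=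
  Submodule.liftQ _ ((chernNumber e).comp (evenCyclicCocycles B).subtype) fun z hz => by
    have := chernNumber_relations e (Submodule.mem_comap.1 hz)
    rw [LinearMap.mem_ker] at this ⊢
    exact this

theorem idemPairing_mk (e : IdemMatrix B) {n : ℕ} (φ : Cochain B (2 * n))
    (h : IsCyclicCocycle φ) : idemPairing e (HCeven.mk φ h) =
      1 / (n.factorial : ℂ) * matrixExt (Fin e.size) φ fun _ => e.mat :=
  chernNumber_single e n φ

theorem idemPairing_equivalent {e f : IdemMatrix B} (h : e.Equivalent f) :
    idemPairing e = idemPairing f := by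
  obtain ⟨x, y, hxy, hyx⟩ := h
  refine LinearMap.ext fun c => ?_
  obtain ⟨z, rfl⟩ := Submodule.Quotient.mk_surjective _ c
  refine chernNumber_congr z fun n φ hφ => ?_
  exact congrArg (1 / (n.factorial : ℂ) * ·) (matrixExt_equiv hφ e.idem f.idem hxy hyx)

theorem idemPairing_sum (e f : IdemMatrix B) :
    idemPairing (e.sum f) = idemPairing e + idemPairing f := by
  have key : chernNumber (e.sum f) = chernNumber e + chernNumber f := by
    refine DFinsupp.lhom_ext (R := ℂ) (M := fun n => Cochain B (2 * n)) fun n φ => ?_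
    change chernNumber (e.sum f) (EvenCochains.single n φ) =
      chernNumber e (EvenCochains.single n φ) + chernNumber f (EvenCochains.single n φ)
    simp only [chernNumber_single]
    rw [← mul_add, ← matrixExt_fromBlocks, ← matrixExt_reindex φ finSumFinEquiv]
    rfl
  refine LinearMap.ext fun c => ?_
  obtain ⟨z, rfl⟩ := Submodule.Quotient.mk_surjective _ c
  exact congrArg (fun F : EvenCochains B →ₗ[ℂ] ℂ => F z) key

/-- The Chern–Connes pairing `⟨[e], [φ]⟩` between `K₀(B)` and `HC^{even}(B)`: additive in the first
variable, linear in the second, and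
`⟨[e], [φ]⟩ = (1 / n!) (φ # Tr)(e, …, e)` for an idempotent matrix `e` and a cyclic cocycle `φ` of
degree `2n`. -/
def chernConnes (B : Type*) [Ring B] [Algebra ℂ B] : K0 B →+ HCeven B →ₗ[ℂ] ℂ :=
  QuotientAddGroup.lift (K0Relations B) (FreeAbelianGroup.lift idemPairing) fun z hz => by
    refine (AddSubgroup.closure_le (K := (FreeAbelianGroup.lift idemPairing).ker)).2 ?_ hz
    rintro _ (⟨e, f, h, rfl⟩ | ⟨e, f, rfl⟩)
    · simp [AddMonoidHom.mem_ker, idemPairing_equivalent h]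
    · simp [AddMonoidHom.mem_ker, idemPairing_sum]

theorem chernConnes_mk {e : B} (he : IsIdempotentElem e) {n : ℕ} (φ : Cochain B (2 * n))
    (h : IsCyclicCocycle φ) : chernConnes B (K0.mk e he) (HCeven.mk φ h) =
      1 / (n.factorial : ℂ) * φ fun _ => e := by
  have : chernConnes B (K0.mk e he) = idemPairing (IdemMatrix.ofIdem e he) := by
    simp [chernConnes, K0.mk]
  rw [this, idemPairing_mk, matrixExt_apply]
  congr 1
  exact Fintype.sum_unique (ι := Fin (2 * n + 1) → Fin 1) _

/-- A linear functional, seen as a `0`-cochain. -/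
def zeroCochain (f : B →ₗ[ℂ] ℂ) : Cochain B 0 :=
  MultilinearMap.ofSubsingleton ℂ B ℂ (0 : Fin 1) f

theorem periodicityS_zeroCochain {f : B →ₗ[ℂ] ℂ} (hf : ∀ x y, f (x * y) = f (y * x))
    (a : Fin 3 → B) : periodicityS (zeroCochain f) a = f (a 0 * a 1 * a 2) := by
  have h1 : f (a 2 * a 0 * a 1) = f (a 0 * a 1 * a 2) := by rw [mul_assoc, hf]
  have h2 : f (a 1 * (a 2 * a 0)) = f (a 0 * a 1 * a 2) := by rw [hf, h1]
  have h3 : f (a 0 * (a 1 * a 2)) = f (a 0 * a 1 * a 2) := by rw [mul_assoc]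
  simp [periodicityS, zeroCochain, Fin.sum_univ_three, face, Fin.contractNth, Fin.ext_iff,
    h1, h2, h3]
  ring

/-- A trace is a cyclic `0`-cocycle. -/
theorem zeroCochain_isCyclicCocycle {f : B →ₗ[ℂ] ℂ} (hf : ∀ x y, f (x * y) = f (y * x)) :
    IsCyclicCocycle (zeroCochain f) := by
  refine ⟨fun a => ?_, MultilinearMap.ext fun a => ?_⟩
  · simp [zeroCochain, Fin.fin_one_eq_zero]
  · simp [hochschildB, zeroCochain, Fin.sum_univ_two, face, Fin.contractNth, hf (a 1)]

theorem periodicityS_isCyclicCocycle {f : B →ₗ[ℂ] ℂ} (hf : ∀ x y, f (x * y) = f (y * x)) :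
    IsCyclicCocycle (periodicityS (zeroCochain f)) := by
  refine ⟨fun a => ?_, MultilinearMap.ext fun a => ?_⟩
  · rw [periodicityS_zeroCochain hf, periodicityS_zeroCochain hf]
    have : (2 : Fin 3) - 1 = 1 := rfl
    have : (0 : Fin 3) - 1 = 2 := rfl
    simp [*, mul_assoc]
  · have h : ∀ a : Fin 3 → B, (periodicityS (zeroCochain f)) a = f (a 0 * a 1 * a 2) :=
      periodicityS_zeroCochain hf
    simp [hochschildB, h, Fin.sum_univ_four, face, Fin.contractNth, Fin.ext_iff]
    rw [hf (a 0 * a 1 * a 2), ← mul_assoc, ← mul_assoc, ← mul_assoc, ← mul_assoc]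
    simp [mul_assoc]
    ring

/-- The class `[S f] ∈ HC^{even}(B)` of a trace `f`. -/
def classS (f : B →ₗ[ℂ] ℂ) (hf : ∀ x y, f (x * y) = f (y * x)) : HCeven B :=
  HCeven.mk (n := 1) (periodicityS (zeroCochain f)) (periodicityS_isCyclicCocycle hf)

end Cyclic

/-! ## The algebraic noncommutative torus and its `ℤ₂`-orbifold -/

section Torus

variable (θ : ℝ)

/-- `λ = e^{2πiθ}`. -/
def lam : ℂ := Complex.exp (2 * Real.pi * Complex.I * θ)

theorem lam_ne_zero : lam θ ≠ 0 := Complex.exp_ne_zero _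

/-- The algebraic noncommutative torus `A_θ^{alg}`: finite sums `∑ a_{n,m} U₁ⁿ U₂ᵐ`, given by their
coefficients `a_{n,m}`, with `U₂ U₁ = λ U₁ U₂`. -/
def NCTorus (_θ : ℝ) : Type := (ℤ × ℤ) →₀ ℂ

namespace NCTorus

instance : AddCommGroup (NCTorus θ) := inferInstanceAs (AddCommGroup ((ℤ × ℤ) →₀ ℂ))

instance : Module ℂ (NCTorus θ) := inferInstanceAs (Module ℂ ((ℤ × ℤ) →₀ ℂ))

/-- The monomial `U₁ⁿ U₂ᵐ`, for `x = (n, m)`. -/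
def mono (x : ℤ × ℤ) : NCTorus θ := Finsupp.single x 1

/-- The linear map with prescribed values on the monomials. -/
def lin {M : Type*} [AddCommGroup M] [Module ℂ M] (v : ℤ × ℤ → M) : NCTorus θ →ₗ[ℂ] M :=
  Finsupp.linearCombination ℂ v

@[simp] theorem lin_mono {M : Type*} [AddCommGroup M] [Module ℂ M] (v : ℤ × ℤ → M) (x : ℤ × ℤ) :
    lin θ v (mono θ x) = v x :=
  (Finsupp.linearCombination_single ℂ 1 x).trans (one_smul ℂ _)

variable {θ}

theorem induction {P : NCTorus θ → Prop} (hadd : ∀ a b, P a → P b → P (a + b))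
    (hsmul : ∀ (c : ℂ) a, P a → P (c • a)) (hmono : ∀ x, P (mono θ x)) (a : NCTorus θ) : P a := by
  have h0 : P 0 := by simpa using hsmul 0 _ (hmono 0)
  refine Finsupp.induction_linear (motive := P) a h0 hadd fun x c => ?_
  have : (Finsupp.single x c : (ℤ × ℤ) →₀ ℂ) = c • Finsupp.single x 1 := by simp
  rw [this]
  exact hsmul c _ (hmono x)

variable (θ)

/-- The product, `(U₁ⁿ U₂ᵐ)(U₁ᵏ U₂ˡ) = λ^{mk} U₁ⁿ⁺ᵏ U₂ᵐ⁺ˡ`. -/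
def mulL : NCTorus θ →ₗ[ℂ] NCTorus θ →ₗ[ℂ] NCTorus θ :=
  lin θ fun x => lin θ fun y => lam θ ^ (x.2 * y.1) • mono θ (x + y)

instance : Mul (NCTorus θ) := ⟨fun a b => mulL θ a b⟩

instance : One (NCTorus θ) := ⟨mono θ 0⟩

theorem mul_def (a b : NCTorus θ) : a * b = mulL θ a b := rfl

theorem one_def : (1 : NCTorus θ) = mono θ 0 := rfl

theorem mono_mul (x y : ℤ × ℤ) :
    mono θ x * mono θ y = lam θ ^ (x.2 * y.1) • mono θ (x + y) := by
  simp [mul_def, mulL]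

theorem mul_assoc' (a b c : NCTorus θ) : a * b * c = a * (b * c) := by
  induction a using induction with
  | hadd a a' h h' => simp only [mul_def, map_add, LinearMap.add_apply] at *; rw [h, h']
  | hsmul r a h => simp only [mul_def, map_smul, LinearMap.smul_apply] at *; rw [h]
  | hmono x =>
  induction b using induction with
  | hadd a a' h h' => simp only [mul_def, map_add, LinearMap.add_apply] at *; rw [h, h']
  | hsmul r a h => simp only [mul_def, map_smul, LinearMap.smul_apply] at *; rw [h]
  | hmono y =>
  induction c using induction with
  | hadd a a' h h' => simp only [mul_def, map_add] at *; rw [h, h']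
  | hsmul r a h => simp only [mul_def, map_smul] at *; rw [h]
  | hmono z =>
    have h1 : mono θ x * mono θ y * mono θ z =
        (lam θ ^ (x.2 * y.1) * lam θ ^ ((x.2 + y.2) * z.1)) • mono θ (x + y + z) := by
      rw [mono_mul, mul_def, map_smul, LinearMap.smul_apply, ← mul_def, mono_mul, smul_smul]
      rfl
    have h2 : mono θ x * (mono θ y * mono θ z) =
        (lam θ ^ (y.2 * z.1) * lam θ ^ (x.2 * (y.1 + z.1))) • mono θ (x + (y + z)) := by
      rw [mono_mul, mul_def, map_smul, ← mul_def, mono_mul, smul_smul]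
      rfl
    rw [h1, h2, ← zpow_add₀ (lam_ne_zero θ), ← zpow_add₀ (lam_ne_zero θ), add_assoc]
    congr 2
    ring

instance : Ring (NCTorus θ) where
  __ := (inferInstance : AddCommGroup (NCTorus θ))
  left_distrib a b c := (mulL θ a).map_add b c
  right_distrib a b c := by simp only [mul_def, map_add, LinearMap.add_apply]
  zero_mul a := by simp only [mul_def, map_zero, LinearMap.zero_apply]
  mul_zero a := (mulL θ a).map_zero
  mul_assoc := mul_assoc' θ
  one_mul a := by
    rw [one_def]
    induction a using induction with
    | hadd a a' h h' => simp only [mul_def, map_add] at *; rw [h, h']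
    | hsmul r a h => simp only [mul_def, map_smul] at *; rw [h]
    | hmono x => simp [mono_mul]
  mul_one a := by
    rw [one_def]
    induction a using induction with
    | hadd a a' h h' => simp only [mul_def, map_add, LinearMap.add_apply] at *; rw [h, h']
    | hsmul r a h => simp only [mul_def, map_smul, LinearMap.smul_apply] at *; rw [h]
    | hmono x => simp [mono_mul]

instance : Algebra ℂ (NCTorus θ) :=
  Algebra.ofModule (fun r a b => by simp only [mul_def, map_smul, LinearMap.smul_apply])
    (fun r a b => by simp only [mul_def, map_smul])

/-- The generator `U₁`. -/
def U₁ : NCTorus θ := mono θ (1, 0)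

/-- The generator `U₂`. -/
def U₂ : NCTorus θ := mono θ (0, 1)

theorem U₂_mul_U₁ : U₂ θ * U₁ θ = lam θ • (U₁ θ * U₂ θ) := by
  simp [U₁, U₂, mono_mul]

/-- The action of `-1 ∈ ℤ₂`: the automorphism with `U₁ ↦ U₁⁻¹` and `U₂ ↦ U₂⁻¹`, so that
`U₁ⁿ U₂ᵐ ↦ U₁⁻ⁿ U₂⁻ᵐ`. -/
def sigma : NCTorus θ →ₗ[ℂ] NCTorus θ := lin θ fun x => mono θ (-x)

@[simp] theorem sigma_mono (x : ℤ × ℤ) : sigma θ (mono θ x) = mono θ (-x) := by simp [sigma]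

@[simp] theorem sigma_sigma (a : NCTorus θ) : sigma θ (sigma θ a) = a := by
  induction a using induction with
  | hadd a b ha hb => rw [map_add, map_add, ha, hb]
  | hsmul c a ha => rw [map_smul, map_smul, ha]
  | hmono x => simp

@[simp] theorem sigma_one : sigma θ 1 = 1 := by simp [one_def]

@[simp] theorem sigma_mul (a b : NCTorus θ) : sigma θ (a * b) = sigma θ a * sigma θ b := by
  induction a using induction with
  | hadd a a' h h' => simp only [add_mul, map_add, h, h']
  | hsmul c a h => simp only [smul_mul_assoc, map_smul, h]
  | hmono x =>
  induction b using induction with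
  | hadd a a' h h' => simp only [mul_add, map_add, h, h']
  | hsmul c a h => simp only [mul_smul_comm, map_smul, h]
  | hmono y =>
    simp only [mono_mul, map_smul, sigma_mono, Prod.snd_neg, Prod.fst_neg, neg_mul_neg]
    rw [neg_add]

/-- The canonical trace, `τ(∑ a_{n,m} U₁ⁿ U₂ᵐ) = a_{0,0}`. -/
def tau : NCTorus θ →ₗ[ℂ] ℂ := lin θ fun x => if x = 0 then 1 else 0

/-- The twisted trace `D_{i,j}`: the functional with `D_{i,j}(a b) = D_{i,j}(b σ(a))`, supported on
the monomials `U₁ⁿ U₂ᵐ` with `n ≡ i` and `m ≡ j` modulo `2`, and normalized by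
`D_{i,j}(U₁ⁱ U₂ʲ) = 1`. -/
def twistedTrace (i j : Fin 2) : NCTorus θ →ₗ[ℂ] ℂ := lin θ fun x =>
  if x.1 % 2 = (i : ℕ) ∧ x.2 % 2 = (j : ℕ) then
    lam θ ^ (-((x.1 * x.2 - ((i : ℕ) : ℤ) * ((j : ℕ) : ℤ)) / 2)) else 0

/-- The derivation with `δ₁(U₁) = 2πi U₁` and `δ₁(U₂) = 0`. -/
def delta₁ : NCTorus θ →ₗ[ℂ] NCTorus θ :=
  lin θ fun x => (2 * Real.pi * Complex.I * (x.1 : ℂ)) • mono θ x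

/-- The derivation with `δ₂(U₁) = 0` and `δ₂(U₂) = 2πi U₂`. -/
def delta₂ : NCTorus θ →ₗ[ℂ] NCTorus θ :=
  lin θ fun x => (2 * Real.pi * Complex.I * (x.2 : ℂ)) • mono θ x

/-- Connes' cyclic `2`-cocycle on `A_θ^{alg}`,
`φ(a₀, a₁, a₂) = (2πi)⁻¹ τ(a₀ (δ₁(a₁) δ₂(a₂) - δ₂(a₁) δ₁(a₂)))`. -/
def phi (a₀ a₁ a₂ : NCTorus θ) : ℂ :=
  (2 * Real.pi * Complex.I)⁻¹ *
    tau θ (a₀ * (delta₁ θ a₁ * delta₂ θ a₂ - delta₂ θ a₁ * delta₁ θ a₂))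

theorem mono_mul_sigma (i j : Fin 2) (x y : ℤ × ℤ) :
    twistedTrace θ i j (mono θ x * mono θ y) =
      twistedTrace θ i j (mono θ y * mono θ (-x)) := by
  simp only [mono_mul, map_smul, smul_eq_mul, twistedTrace, lin_mono, Prod.fst_add, Prod.snd_add,
    Prod.fst_neg, Prod.snd_neg]
  have h1 : (y.1 + -x.1) % 2 = (x.1 + y.1) % 2 := by omega
  have h2 : (y.2 + -x.2) % 2 = (x.2 + y.2) % 2 := by omega
  rw [h1, h2]
  split_ifs
  · rw [← zpow_add₀ (lam_ne_zero θ), ← zpow_add₀ (lam_ne_zero θ)]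
    congr 1
    have : (x.1 + y.1) * (x.2 + y.2) - ((i : ℕ) : ℤ) * ((j : ℕ) : ℤ) =
        (y.1 + -x.1) * (y.2 + -x.2) - ((i : ℕ) : ℤ) * ((j : ℕ) : ℤ) +
          (x.1 * y.2 + y.1 * x.2) * 2 := by ring
    rw [this, Int.add_mul_ediv_right _ _ (by norm_num)]
    ring
  · simp

theorem twistedTrace_mul (i j : Fin 2) (a b : NCTorus θ) :
    twistedTrace θ i j (a * b) = twistedTrace θ i j (b * sigma θ a) := by
  induction a using induction with
  | hadd a a' h h' => simp only [add_mul, mul_add, map_add, h, h']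
  | hsmul c a h => simp only [smul_mul_assoc, mul_smul_comm, map_smul, h]
  | hmono x =>
  induction b using induction with
  | hadd a a' h h' => simp only [add_mul, mul_add, map_add, h, h']
  | hsmul c a h => simp only [smul_mul_assoc, mul_smul_comm, map_smul, h]
  | hmono y => rw [sigma_mono, mono_mul_sigma]

theorem tau_mul_comm (a b : NCTorus θ) : tau θ (a * b) = tau θ (b * a) := by
  induction a using induction with
  | hadd a a' h h' => simp only [add_mul, mul_add, map_add, h, h']
  | hsmul c a h => simp only [smul_mul_assoc, mul_smul_comm, map_smul, h]
  | hmono x =>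
  induction b using induction with
  | hadd a a' h h' => simp only [add_mul, mul_add, map_add, h, h']
  | hsmul c a h => simp only [smul_mul_assoc, mul_smul_comm, map_smul, h]
  | hmono y =>
    simp only [mono_mul, map_smul, tau, lin_mono, smul_eq_mul, add_comm y x]
    by_cases h : x + y = 0
    · have h1 : y = -x := (neg_eq_of_add_eq_zero_right h).symm
      subst h1
      simp [mul_comm]
    · simp [h]

theorem tau_sigma (a : NCTorus θ) : tau θ (sigma θ a) = tau θ a := by
  induction a using induction with
  | hadd a a' h h' => simp only [map_add, h, h']
  | hsmul c a h => simp only [map_smul, h]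
  | hmono x => simp [tau]

theorem twistedTrace_sigma (i j : Fin 2) (a : NCTorus θ) :
    twistedTrace θ i j (sigma θ a) = twistedTrace θ i j a := by
  simpa using (twistedTrace_mul θ i j a 1).symm

section Delta

variable (k : ℤ × ℤ →+ ℂ)

/-- The derivation that multiplies each monomial by its weight. -/
def delta : NCTorus θ →ₗ[ℂ] NCTorus θ := lin θ fun x => k x • mono θ x

theorem delta_mul (a b : NCTorus θ) :
    delta θ k (a * b) = delta θ k a * b + a * delta θ k b := by
  induction a using induction with
  | hadd a a' h h' => simp only [add_mul, map_add, h, h']; abel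
  | hsmul c a h => simp only [smul_mul_assoc, map_smul, h, smul_add]
  | hmono x =>
  induction b using induction with
  | hadd a a' h h' => simp only [mul_add, map_add, h, h']; abel
  | hsmul c a h => simp only [mul_smul_comm, map_smul, h, smul_add]
  | hmono y =>
    simp only [mono_mul, map_smul, delta, lin_mono, smul_mul_assoc, mul_smul_comm, map_add]
    module

theorem delta_sigma (a : NCTorus θ) : delta θ k (sigma θ a) = -sigma θ (delta θ k a) := by
  induction a using induction with
  | hadd a a' h h' => simp only [map_add, h, h']; abel
  | hsmul c a h => simp only [map_smul, h, smul_neg]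
  | hmono x => simp [delta]

theorem tau_delta (a : NCTorus θ) : tau θ (delta θ k a) = 0 := by
  induction a using induction with
  | hadd a a' h h' => simp only [map_add, h, h', add_zero]
  | hsmul c a h => simp only [map_smul, h, smul_zero]
  | hmono x =>
    by_cases hx : x = 0
    · subst hx; simp [delta]
    · simp [delta, tau, hx]

theorem delta_comm (k l : ℤ × ℤ →+ ℂ) (a : NCTorus θ) :
    delta θ k (delta θ l a) = delta θ l (delta θ k a) := by
  induction a using induction with
  | hadd a a' h h' => simp only [map_add, h, h']
  | hsmul c a h => simp only [map_smul, h]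
  | hmono x => simp [delta, smul_smul, mul_comm]

end Delta

/-- The weight of `δ₁`. -/
def weight₁ : ℤ × ℤ →+ ℂ :=
  AddMonoidHom.mk' (fun x => 2 * Real.pi * Complex.I * (x.1 : ℂ)) fun x y => by
    simp [mul_add]

/-- The weight of `δ₂`. -/
def weight₂ : ℤ × ℤ →+ ℂ :=
  AddMonoidHom.mk' (fun x => 2 * Real.pi * Complex.I * (x.2 : ℂ)) fun x y => by
    simp [mul_add]

theorem delta₁_eq : delta₁ θ = delta θ weight₁ := rfl

theorem delta₂_eq : delta₂ θ = delta θ weight₂ := rfl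

theorem phi_cyclic (a b c : NCTorus θ) : phi θ c a b = phi θ a b c := by
  unfold phi
  congr 1
  rw [delta₁_eq, delta₂_eq]
  set d := delta θ weight₁
  set e := delta θ weight₂
  have hd : ∀ x y, d (x * y) = d x * y + x * d y := delta_mul θ _
  have he : ∀ x y, e (x * y) = e x * y + x * e y := delta_mul θ _
  have h1 := tau_delta θ weight₁ (a * (e b * c))
  have h2 := tau_delta θ weight₂ (a * (d b * c))
  change tau θ (d _) = 0 at h1
  change tau θ (e _) = 0 at h2
  have h3 : e (d b) = d (e b) := delta_comm θ _ _ _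
  have h4 := tau_mul_comm θ c (d a * e b)
  have h5 := tau_mul_comm θ c (e a * d b)
  simp only [hd, he, h3, mul_add, map_add, mul_sub, map_sub, mul_assoc] at *
  linear_combination h4 - h5 + h1 - h2

theorem phi_sigma (a b c : NCTorus θ) :
    phi θ (sigma θ a) (sigma θ b) (sigma θ c) = phi θ a b c := by
  simp only [phi, delta₁_eq, delta₂_eq, delta_sigma, neg_mul_neg, ← sigma_mul, ← map_sub,
    tau_sigma]

theorem phi_hochschild (a b c d : NCTorus θ) :
    phi θ (a * b) c d - phi θ a (b * c) d + phi θ a b (c * d) - phi θ (d * a) b c = 0 := by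
  simp only [phi, delta₁_eq, delta₂_eq, delta_mul]
  rw [mul_assoc d a, tau_mul_comm θ d]
  simp only [mul_add, add_mul, mul_sub, sub_mul, map_add, map_sub, mul_assoc]
  ring

end NCTorus

/-- The algebraic noncommutative toroidal orbifold `A_θ^{alg} ⋊ ℤ₂`. The pair `(a, b)` stands for
`a + b t`, where `t² = 1` and `t a t = σ(a)`. -/
def Orbifold : Type := NCTorus θ × NCTorus θ

namespace Orbifold

open NCTorus

instance : AddCommGroup (Orbifold θ) := inferInstanceAs (AddCommGroup (NCTorus θ × NCTorus θ))

instance : Module ℂ (Orbifold θ) := inferInstanceAs (Module ℂ (NCTorus θ × NCTorus θ))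

variable {θ}

/-- The element `a + b t`. -/
def mk (a b : NCTorus θ) : Orbifold θ := (a, b)

/-- The coefficient `a` of `a + b t`. -/
def fst : Orbifold θ →ₗ[ℂ] NCTorus θ := LinearMap.fst ℂ (NCTorus θ) (NCTorus θ)

/-- The coefficient `b` of `a + b t`. -/
def snd : Orbifold θ →ₗ[ℂ] NCTorus θ := LinearMap.snd ℂ (NCTorus θ) (NCTorus θ)

theorem ext' {x y : Orbifold θ} (h₁ : fst x = fst y) (h₂ : snd x = snd y) : x = y :=
  Prod.ext h₁ h₂

@[simp] theorem fst_mk (a b : NCTorus θ) : fst (mk a b) = a := rfl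

@[simp] theorem snd_mk (a b : NCTorus θ) : snd (mk a b) = b := rfl

/-- `(a + b t)(c + d t) = (a c + b σ(d)) + (a d + b σ(c)) t`. -/
instance : Mul (Orbifold θ) :=
  ⟨fun x y => mk (fst x * fst y + snd x * sigma θ (snd y)) (fst x * snd y + snd x * sigma θ (fst y))⟩

instance : One (Orbifold θ) := ⟨mk 1 0⟩

@[simp] theorem fst_mul (x y : Orbifold θ) :
    fst (x * y) = fst x * fst y + snd x * sigma θ (snd y) := rfl

@[simp] theorem snd_mul (x y : Orbifold θ) :
    snd (x * y) = fst x * snd y + snd x * sigma θ (fst y) := rfl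

@[simp] theorem fst_one : fst (1 : Orbifold θ) = 1 := rfl

@[simp] theorem snd_one : snd (1 : Orbifold θ) = 0 := rfl

instance : Ring (Orbifold θ) where
  __ := (inferInstance : AddCommGroup (Orbifold θ))
  left_distrib x y z := ext' (by simp only [fst_mul, map_add, mul_add]; abel)
    (by simp only [snd_mul, map_add, mul_add]; abel)
  right_distrib x y z := ext' (by simp only [fst_mul, map_add, add_mul]; abel)
    (by simp only [snd_mul, map_add, add_mul]; abel)
  zero_mul x := ext' (by simp only [fst_mul, map_zero, zero_mul, add_zero])
    (by simp only [snd_mul, map_zero, zero_mul, add_zero])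
  mul_zero x := ext' (by simp only [fst_mul, map_zero, mul_zero, add_zero])
    (by simp only [snd_mul, map_zero, mul_zero, add_zero])
  mul_assoc x y z := ext'
    (by simp only [fst_mul, snd_mul, map_add, sigma_mul, sigma_sigma, mul_add, add_mul, mul_assoc]
        abel)
    (by simp only [fst_mul, snd_mul, map_add, sigma_mul, sigma_sigma, mul_add, add_mul, mul_assoc]
        abel)
  one_mul x := ext' (by simp) (by simp)
  mul_one x := ext' (by simp) (by simp)

instance : Algebra ℂ (Orbifold θ) :=
  Algebra.ofModule (fun r x y => ext' (by simp) (by simp)) (fun r x y => ext' (by simp) (by simp))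

variable (θ)

/-- The element `t`. -/
def t : Orbifold θ := mk 0 1

/-- The element `U₁`. -/
def U₁ : Orbifold θ := mk (NCTorus.U₁ θ) 0

/-- The element `U₂`. -/
def U₂ : Orbifold θ := mk (NCTorus.U₂ θ) 0

theorem t_mul_t : t θ * t θ = 1 := ext' (by simp [t]) (by simp [t])

theorem t_mul_mul_t (a : NCTorus θ) : t θ * mk a 0 * t θ = mk (sigma θ a) 0 :=
  ext' (by simp [t]) (by simp [t])

/-- The trace `τ(a + b t) = τ(a)`. -/
def trace : Orbifold θ →ₗ[ℂ] ℂ := tau θ ∘ₗ fst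

/-- The trace `D_{i,j}(a + b t) = D_{i,j}(b)`. -/
def D (i j : Fin 2) : Orbifold θ →ₗ[ℂ] ℂ := twistedTrace θ i j ∘ₗ snd

theorem trace_comm (x y : Orbifold θ) : trace θ (x * y) = trace θ (y * x) := by
  simp only [trace, LinearMap.comp_apply, fst_mul, map_add]
  rw [tau_mul_comm θ (fst x), ← tau_sigma θ (snd x * _), sigma_mul, sigma_sigma,
    tau_mul_comm θ _ (snd y)]

theorem D_comm (i j : Fin 2) (x y : Orbifold θ) : D θ i j (x * y) = D θ i j (y * x) := by
  simp only [D, LinearMap.comp_apply, snd_mul, map_add]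
  rw [twistedTrace_mul θ i j (fst x), ← twistedTrace_mul θ i j (fst y), add_comm]

/-- The extension of Connes' cyclic `2`-cocycle `φ` to `A_θ^{alg} ⋊ ℤ₂`:
`φ(a₀ t^{g₀}, a₁ t^{g₁}, a₂ t^{g₂}) = φ(a₀, σ^{g₀}(a₁), σ^{g₀ + g₁}(a₂))` if `g₀ + g₁ + g₂` is
even, and `0` otherwise. -/
def connesCocycle : Cochain (Orbifold θ) 2 :=
  MultilinearMap.mk' (fun x =>
      phi θ (fst (x 0)) (fst (x 1)) (fst (x 2))
      + phi θ (fst (x 0)) (snd (x 1)) (sigma θ (snd (x 2)))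
      + phi θ (snd (x 0)) (sigma θ (fst (x 1))) (sigma θ (snd (x 2)))
      + phi θ (snd (x 0)) (sigma θ (snd (x 1))) (fst (x 2)))
    (fun x i a b => by
      fin_cases i <;> simp [phi, add_mul, mul_add, mul_sub] <;> ring)
    (fun x i c a => by
      fin_cases i <;> simp [phi, mul_sub] <;> ring)

theorem connesCocycle_apply (x : Fin 3 → Orbifold θ) : connesCocycle θ x =
      phi θ (fst (x 0)) (fst (x 1)) (fst (x 2))
      + phi θ (fst (x 0)) (snd (x 1)) (sigma θ (snd (x 2)))
      + phi θ (snd (x 0)) (sigma θ (fst (x 1))) (sigma θ (snd (x 2)))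
      + phi θ (snd (x 0)) (sigma θ (snd (x 1))) (fst (x 2)) := rfl

theorem connesCocycle_isCyclicCocycle : IsCyclicCocycle (connesCocycle θ) := by
  refine ⟨fun x => ?_, MultilinearMap.ext fun x => ?_⟩
  · have e1 : (2 : Fin 3) - 1 = 1 := rfl
    have e0 : (0 : Fin 3) - 1 = 2 := rfl
    have h1 := phi_cyclic θ (fst (x 0)) (fst (x 1)) (fst (x 2))
    have h2 := phi_cyclic θ (snd (x 0)) (sigma θ (snd (x 1))) (fst (x 2))
    have h3 := phi_sigma θ (snd (x 2)) (sigma θ (fst (x 0))) (sigma θ (snd (x 1)))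
    have h4 := phi_cyclic θ (fst (x 0)) (snd (x 1)) (sigma θ (snd (x 2)))
    have h5 := phi_sigma θ (snd (x 2)) (sigma θ (snd (x 0))) (fst (x 1))
    have h6 := phi_cyclic θ (snd (x 0)) (sigma θ (fst (x 1))) (sigma θ (snd (x 2)))
    rw [sigma_sigma, sigma_sigma] at h3
    rw [sigma_sigma] at h5
    rw [connesCocycle_apply, connesCocycle_apply]
    simp only [e0, e1, sub_self]
    linear_combination h1 + h2 - h3 + h4 - h5 + h6
  · have a1 := phi_hochschild θ (fst (x 0)) (fst (x 1)) (fst (x 2)) (fst (x 3))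
    have a2 := phi_hochschild θ (fst (x 0)) (fst (x 1)) (snd (x 2)) (sigma θ (snd (x 3)))
    have a3 := phi_hochschild θ (fst (x 0)) (snd (x 1)) (sigma θ (fst (x 2))) (sigma θ (snd (x 3)))
    have a4 := phi_hochschild θ (fst (x 0)) (snd (x 1)) (sigma θ (snd (x 2))) (fst (x 3))
    have a5 := phi_hochschild θ (snd (x 0)) (sigma θ (fst (x 1))) (sigma θ (fst (x 2)))
      (sigma θ (snd (x 3)))
    have a6 := phi_hochschild θ (snd (x 0)) (sigma θ (fst (x 1))) (sigma θ (snd (x 2))) (fst (x 3))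
    have a7 := phi_hochschild θ (snd (x 0)) (sigma θ (snd (x 1))) (fst (x 2)) (fst (x 3))
    have a8 := phi_hochschild θ (snd (x 0)) (sigma θ (snd (x 1))) (snd (x 2)) (sigma θ (snd (x 3)))
    have b2 := phi_sigma θ (snd (x 3) * sigma θ (fst (x 0))) (sigma θ (fst (x 1)))
      (sigma θ (snd (x 2)))
    have b3 := phi_sigma θ (snd (x 3) * sigma θ (fst (x 0))) (sigma θ (snd (x 1))) (fst (x 2))
    have b5 := phi_sigma θ (snd (x 3) * sigma θ (snd (x 0))) (fst (x 1)) (fst (x 2))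
    have b8 := phi_sigma θ (snd (x 3) * sigma θ (snd (x 0))) (snd (x 1)) (sigma θ (snd (x 2)))
    have hadd₀ : ∀ a a' b c : NCTorus θ, phi θ (a + a') b c = phi θ a b c + phi θ a' b c := by
      intro a a' b c; simp [phi, add_mul]; ring
    have hadd₁ : ∀ a b b' c : NCTorus θ, phi θ a (b + b') c = phi θ a b c + phi θ a b' c := by
      intro a b b' c; simp [phi, add_mul, mul_add, mul_sub]; ring
    have hadd₂ : ∀ a b c c' : NCTorus θ, phi θ a b (c + c') = phi θ a b c + phi θ a b c' := by
      intro a b c c'; simp [phi, mul_add, mul_sub]; ring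
    simp only [sigma_mul, sigma_sigma] at b2 b3 b5 b8
    have hsum : ∀ F : Fin (2 + 2) → ℂ, ∑ i, F i = F 0 + F 1 + F 2 + F 3 := Fin.sum_univ_four
    simp only [hochschildB, _root_.sum_apply, _root_.smul_apply, coface_apply,
      connesCocycle_apply, hsum, smul_eq_mul, _root_.zero_apply]
    simp [face, Fin.contractNth, Fin.ext_iff, hadd₀, hadd₁, hadd₂]
    linear_combination a1 + a2 + a3 + a4 + a5 + a6 + a7 + a8 + b2 + b3 + b5 + b8

/-- The class `[Sτ]`. -/
def classSTrace : HCeven (Orbifold θ) := classS (trace θ) (trace_comm θ)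

/-- The class `[S D_{i,j}]`. -/
def classSD (i j : Fin 2) : HCeven (Orbifold θ) := classS (D θ i j) (D_comm θ i j)

/-- The class `[φ]`. -/
def classPhi : HCeven (Orbifold θ) :=
  HCeven.mk (n := 1) (connesCocycle θ) (connesCocycle_isCyclicCocycle θ)

/-- The element `p = (1 + t) / 2`. -/
def p : Orbifold θ := (1 / 2 : ℂ) • (1 + t θ)

/-- The element `q₁ = (1 - U₁ t) / 2`. -/
def q₁ : Orbifold θ := (1 / 2 : ℂ) • (1 - U₁ θ * t θ)

/-- The element `q₂ = (1 - U₂ t) / 2`. -/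
def q₂ : Orbifold θ := (1 / 2 : ℂ) • (1 - U₂ θ * t θ)

/-- The element `r = (1 - √λ U₁ U₂ t) / 2`, where `s` is a square root of `λ`. -/
def r (s : ℂ) : Orbifold θ := (1 / 2 : ℂ) • (1 - s • (U₁ θ * U₂ θ * t θ))

variable {θ} in
theorem isIdempotent_half {u : Orbifold θ} (hu : u * u = 1) :
    IsIdempotentElem ((1 / 2 : ℂ) • (1 - u)) := by
  rw [IsIdempotentElem, smul_mul_smul_comm]
  have : (1 - u) * (1 - u) = (2 : ℂ) • (1 - u) := by
    rw [mul_sub, sub_mul, sub_mul, hu, one_mul, mul_one, one_mul, two_smul]; abel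
  rw [this, smul_smul]
  norm_num

theorem p_idem : IsIdempotentElem (p θ) := by
  have := isIdempotent_half (u := -t θ) (by rw [neg_mul_neg, t_mul_t])
  rwa [sub_neg_eq_add] at this

theorem q₁_idem : IsIdempotentElem (q₁ θ) :=
  isIdempotent_half (ext' (by simp [U₁, t, NCTorus.U₁, mono_mul, NCTorus.one_def]; rfl)
    (by simp [U₁, t]))

theorem q₂_idem : IsIdempotentElem (q₂ θ) :=
  isIdempotent_half (ext' (by simp [U₂, t, NCTorus.U₂, mono_mul, NCTorus.one_def]; rfl)
    (by simp [U₂, t]))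

theorem r_idem {s : ℂ} (hs : s ^ 2 = lam θ) : IsIdempotentElem (r θ s) := by
  refine isIdempotent_half (ext' ?_ (by simp [U₁, U₂, t]))
  have h0 := lam_ne_zero θ
  simp [U₁, U₂, t, NCTorus.U₁, NCTorus.U₂, mono_mul, NCTorus.one_def, smul_smul]
  rw [← pow_two, hs, mul_inv_cancel₀ h0, one_smul]
  rfl

/-- The classes `[1], [p], [q₁], [q₂], [r]` in `K₀(A_θ^{alg} ⋊ ℤ₂)`; `s` is a square root of `λ`. -/
def projectionClass {s : ℂ} (hs : s ^ 2 = lam θ) : Fin 5 → K0 (Orbifold θ) :=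
  ![K0.mk 1 IsIdempotentElem.one, K0.mk (p θ) (p_idem θ), K0.mk (q₁ θ) (q₁_idem θ),
    K0.mk (q₂ θ) (q₂_idem θ), K0.mk (r θ s) (r_idem θ hs)]

/-- The classes `[Sτ], [S D_{0,0}], [S D_{1,0}], [S D_{0,1}], [S D_{1,1}], [φ]` in
`HC^{even}(A_θ^{alg} ⋊ ℤ₂)`. -/
def cocycleClass : Fin 6 → HCeven (Orbifold θ) :=
  ![classSTrace θ, classSD θ 0 0, classSD θ 1 0, classSD θ 0 1, classSD θ 1 1, classPhi θ]

end Orbifold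

end Torus

end

end ChernConnes

/-! Write `U^x` for the monomial with exponent `x` in `ℤ × ℤ`. All five idempotents have the shape
`c + d U^x t`, with scalars `c`, `d` and a single monomial, so the whole table reduces to one row
formula in `c`, `d` and `x`: `chernConnes_cocycleClass`.

The pairing of an idempotent `e` with the class of `S f`, for a trace `f`, is `f (e * e * e) = f e`
(`chernConnes_classS`). Hence the column of `τ` reads off `c`, and the column of `D_{i,j}` reads off
`d` times the value of the twisted trace at `U^x`. The idempotents `p`, `q₁`, `q₂`, `r` use `x =
(0,0), (1,0), (0,1), (1,1)`, one representative of each class of `ℤ²` modulo `2ℤ²`, and each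
`D_{i,j}` is supported on one such class and equals `1` at its representative. The four columns of
the `D_{i,j}` therefore form a diagonal block on these four rows, while the row of `1` is zero there
because `d = 0`.

The column of `φ` vanishes for a reason of its own (`connesCocycle_mono`). Each of the four terms of
the extended cocycle either has a scalar in a differentiated slot, and derivations kill scalars, or
is evaluated on `U^x` and `U^{-x}`, whose exponents are parallel, so that the antisymmetric
expression in `δ₁`, `δ₂` is zero.

For independence, an integral relation in `K₀` is paired with the traces. The diagonal block has
entries `1/2, -1/2, -1/2, -√λ/2`, all nonzero since `λ ≠ 0`; it kills the coefficients of `p`, `q₁`,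
`q₂`, `r`, and the column of `τ` then kills that of `1`. -/

namespace ChernConnes

/-! ### Pairing an idempotent with the class of a trace. -/

section Pairing

variable {B : Type*} [Ring B] [Algebra ℂ B]

/-- The class is represented in degree `2` by `S f`, whose value on `(e, e, e)` is `f (e * e * e)`;
idempotency collapses the cube. This brings the degree-`2` pairing back to evaluation of the trace
itself. -/
theorem chernConnes_classS {e : B} (he : IsIdempotentElem e) (f : B →ₗ[ℂ] ℂ)
    (hf : ∀ x y, f (x * y) = f (y * x)) :
    chernConnes B (K0.mk e he) (classS f hf) = f e := by
  -- Degree `2n = 2`, so the normalizing factor is `1 / 1!`, which the final `simp` removes.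
  refine (chernConnes_mk he (n := 1) _ _).trans ?_
  refine (congrArg _ (periodicityS_zeroCochain hf fun _ => e)).trans ?_
  rw [he.eq, he.eq]
  simp

end Pairing

/-! ### Vanishing of Connes' cocycle on scalars and on opposite monomials. -/

namespace NCTorus

variable (θ : ℝ)

@[simp] theorem tau_one : tau θ 1 = 1 := by simp [tau, one_def]

@[simp] theorem delta_one (k : ℤ × ℤ →+ ℂ) : delta θ k 1 = 0 := by simp [delta, one_def]

/-- Both terms of `phi` differentiate this slot, and `δ₁`, `δ₂` kill scalars. -/
theorem phi_smul_one_middle (a c : NCTorus θ) (z : ℂ) : phi θ a (z • 1) c = 0 := by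
  simp [phi, delta₁_eq, delta₂_eq]

theorem phi_smul_one_right (a b : NCTorus θ) (z : ℂ) : phi θ a b (z • 1) = 0 := by
  simp [phi, delta₁_eq, delta₂_eq]

/-- Monomials are eigenvectors of `δ₁` and `δ₂`, and the eigenvalues at `-x` are the negatives of
those at `x`. So `phi` acquires the determinant of the exponents `x` and `-x`, which is zero because
they are parallel. The slot `a` plays no role. -/
theorem phi_mono_sigma (a : NCTorus θ) (d : ℂ) (x : ℤ × ℤ) :
    phi θ a (d • mono θ x) (sigma θ (d • mono θ x)) = 0 := by
  -- Both sides are `-(2πi)² x.1 x.2` times the same product of `d U^x` and `d U^{-x}`, in the same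
  -- order, so no commutation relation is needed.
  have h : delta₁ θ (d • mono θ x) * delta₂ θ (sigma θ (d • mono θ x)) =
      delta₂ θ (d • mono θ x) * delta₁ θ (sigma θ (d • mono θ x)) := by
    simp only [map_smul, sigma_mono, delta₁, delta₂, lin_mono, smul_mul_assoc, mul_smul_comm,
      smul_smul, Prod.fst_neg, Prod.snd_neg, Int.cast_neg]
    congr 1
    ring
  rw [phi, h, sub_self, mul_zero, map_zero, mul_zero]

end NCTorus

/-! ### Connes' cocycle on elements `c + d U^x t`. -/

namespace Orbifold

open NCTorus

variable (θ : ℝ)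

/-- No idempotency is involved: the four terms of the extended cocycle vanish separately for any
`c`, `d`, `x`. -/
theorem connesCocycle_mono (c d : ℂ) (x : ℤ × ℤ) :
    connesCocycle θ (fun _ => mk (c • 1) (d • mono θ x)) = 0 := by
  rw [connesCocycle_apply]
  simp only [fst_mk, snd_mk]
  -- The terms with no `t` and with `t` in slots `0, 2` have a scalar in the middle (in the latter
  -- `σ (c • 1) = c • 1`); the one with `t` in slots `0, 1` has a scalar on the right; only `t` in
  -- slots `1, 2` needs the cancellation between `U^x` and `U^{-x}`.
  rw [phi_smul_one_middle, phi_mono_sigma, phi_smul_one_right, map_smul, sigma_one,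
    phi_smul_one_middle]
  simp

/-! ### Normal form `c + d U^x t` of the five idempotents. -/

theorem one_eq_mk : (1 : Orbifold θ) = mk ((1 : ℂ) • 1) ((0 : ℂ) • mono θ 0) :=
  ext' (by simp) (by simp)

theorem p_eq_mk : p θ = mk ((1 / 2 : ℂ) • 1) ((1 / 2 : ℂ) • mono θ (0, 0)) :=
  ext' (by simp [p, t]) (by simp [p, t, one_def]; rfl)

theorem q₁_eq_mk : q₁ θ = mk ((1 / 2 : ℂ) • 1) ((-1 / 2 : ℂ) • mono θ (1, 0)) :=
  ext' (by simp [q₁, t, U₁]) (by simp [q₁, t, U₁, NCTorus.U₁, neg_div])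

theorem q₂_eq_mk : q₂ θ = mk ((1 / 2 : ℂ) • 1) ((-1 / 2 : ℂ) • mono θ (0, 1)) :=
  ext' (by simp [q₂, t, U₂]) (by simp [q₂, t, U₂, NCTorus.U₂, neg_div])

/-- The product `U₁ U₂` is already in normal order, so it equals the monomial of exponent `(1, 1)`
with no power of `λ`. The coefficient of `t` is thus `-s / 2`, valid for every `s`; that `s` is a
root of `λ` matters only for idempotency. -/
theorem r_eq_mk (s : ℂ) : r θ s = mk ((1 / 2 : ℂ) • 1) ((-s / 2 : ℂ) • mono θ (1, 1)) :=
  ext' (by simp [r, t, U₁, U₂])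
    (by
      simp [r, t, U₁, U₂, NCTorus.U₁, NCTorus.U₂, mono_mul, smul_smul]
      rw [← neg_smul]
      congr 1
      ring)

/-! ### The pairing table. -/

/-- The pairings of the class of an idempotent `c + d U₁ⁿ U₂ᵐ t` with the six cocycle classes. -/
theorem chernConnes_cocycleClass {e : Orbifold θ} (he : IsIdempotentElem e) {c d : ℂ}
    {x : ℤ × ℤ} (h : e = mk (c • 1) (d • mono θ x)) (j : Fin 6) :
    chernConnes (Orbifold θ) (K0.mk e he) (cocycleClass θ j) =
      ![c, d * twistedTrace θ 0 0 (mono θ x), d * twistedTrace θ 1 0 (mono θ x),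
        d * twistedTrace θ 0 1 (mono θ x), d * twistedTrace θ 1 1 (mono θ x), 0] j := by
  have hD : ∀ i j, chernConnes (Orbifold θ) (K0.mk e he) (classSD θ i j) =
      d * twistedTrace θ i j (mono θ x) := fun i j => by
    rw [classSD, chernConnes_classS he, h]
    simp [D]
  fin_cases j
  · change chernConnes (Orbifold θ) (K0.mk e he) (classSTrace θ) = c
    rw [classSTrace, chernConnes_classS he, h]
    simp [trace]
  · exact hD 0 0
  · exact hD 1 0
  · exact hD 0 1
  · exact hD 1 1
  -- `φ` is not of the form `S f`, so this column is computed from the cochain representative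
  -- itself.
  · change chernConnes (Orbifold θ) (K0.mk e he) (classPhi θ) = 0
    refine (chernConnes_mk he (n := 1) _ _).trans ?_
    refine mul_eq_zero_of_right _ ?_
    rw [h]
    exact connesCocycle_mono θ c d x

theorem pairing_table {s : ℂ} (hs : s ^ 2 = lam θ) :
    (Matrix.of fun (i : Fin 5) (j : Fin 6) =>
      chernConnes (Orbifold θ) (projectionClass θ hs i) (cocycleClass θ j)) =
      !![1,     0,     0,      0,      0,      0;
         1 / 2, 1 / 2, 0,      0,      0,      0;
         1 / 2, 0,     -1 / 2, 0,      0,      0;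
         1 / 2, 0,     0,      -1 / 2, 0,      0;
         1 / 2, 0,     0,      0,      -s / 2, 0] := by
  ext i j
  rw [Matrix.of_apply]
  fin_cases i
  -- Here `d = 0`, so the choice of monomial is immaterial and every twisted trace contributes zero.
  · refine (chernConnes_cocycleClass θ _ (one_eq_mk θ) j).trans ?_
    fin_cases j <;> simp
  · refine (chernConnes_cocycleClass θ _ (p_eq_mk θ) j).trans ?_
    fin_cases j <;> simp [twistedTrace]
  · refine (chernConnes_cocycleClass θ _ (q₁_eq_mk θ) j).trans ?_
    fin_cases j <;> simp [twistedTrace]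
  · refine (chernConnes_cocycleClass θ _ (q₂_eq_mk θ) j).trans ?_
    fin_cases j <;> simp [twistedTrace]
  · refine (chernConnes_cocycleClass θ _ (r_eq_mk θ s) j).trans ?_
    -- Parity leaves only `D_{1,1}`. Its exponent of `λ` at `(1, 1)` is `-((1 - 1) / 2) = 0`, so the
    -- entry is exactly `-s / 2`.
    fin_cases j <;> simp [twistedTrace]

/-- The five trace columns are triangular with nonzero diagonal, and `ℤ` embeds in `ℂ`; the column
of `φ` carries no information. -/
theorem linearIndependent_projectionClass {s : ℂ} (hs : s ^ 2 = lam θ) :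
    LinearIndependent ℤ (projectionClass θ hs) := by
  have hs0 : s ≠ 0 := by
    rintro rfl
    exact lam_ne_zero θ (by simpa using hs.symm)
  rw [Fintype.linearIndependent_iff]
  intro g hg
  -- Additivity of the pairing in its `K₀` variable turns the relation into one complex linear
  -- equation per cocycle class.
  have key : ∀ j, ∑ i, (g i : ℂ) *
      chernConnes (Orbifold θ) (projectionClass θ hs i) (cocycleClass θ j) = 0 := fun j => by
    have := congrArg (fun z => chernConnes (Orbifold θ) z (cocycleClass θ j)) hg
    simpa only [map_sum, map_zsmul, LinearMap.sum_apply, LinearMap.smul_apply, zsmul_eq_mul,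
      map_zero, LinearMap.zero_apply] using this
  have hT := fun i j => congrFun (congrFun (pairing_table θ hs) i) j
  simp only [Matrix.of_apply] at hT
  simp only [hT, Fin.sum_univ_five] at key
  have h1 : g 1 = 0 := by simpa using key 1
  have h2 : g 2 = 0 := by simpa using key 2
  have h3 : g 3 = 0 := by simpa using key 3
  -- The only entry depending on `θ`, namely `-s / 2`: here `s ≠ 0` is needed.
  have h4 : g 4 = 0 := by simpa [hs0] using key 4
  -- The trace sees all five classes, so its column is used last, when only `[1]` remains.
  have h0 : g 0 = 0 := by simpa [h1, h2, h3, h4] using key 0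
  intro i
  fin_cases i <;> assumption

end Orbifold

end ChernConnes

theorem theorem1p3 (θ : ℝ) (s : ℂ) (hs : s ^ 2 = ChernConnes.lam θ) :
    (Matrix.of fun (i : Fin 5) (j : Fin 6) =>
      ChernConnes.chernConnes (ChernConnes.Orbifold θ)
        (ChernConnes.Orbifold.projectionClass θ hs i) (ChernConnes.Orbifold.cocycleClass θ j)) =
      !![1,     0,     0,      0,      0,      0;
         1 / 2, 1 / 2, 0,      0,      0,      0;
         1 / 2, 0,     -1 / 2, 0,      0,      0;
         1 / 2, 0,     0,      -1 / 2, 0,      0;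
         1 / 2, 0,     0,      0,      -s / 2, 0] ∧
    LinearIndependent ℤ (ChernConnes.Orbifold.projectionClass θ hs) :=
  ⟨ChernConnes.Orbifold.pairing_table θ hs,
    ChernConnes.Orbifold.linearIndependent_projectionClass θ hs⟩
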